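/- Let $p$ be a prime, let $E\subset\overline{\mathbf Q}_p$ be a finite extension of $\mathbf Q_p$ with valuation ring $\mathcal O$ and residue field $k$, let $F$ be a number field and $v$ a finite place of $F$, with completion $F_v$ and absolute Galois group $G_{F_v}$, and let $q_v$ be the order of the residue field of $F_v$. Suppose that $q_v=1$ in $k$. Let $\bar r:G_{F_v}\to \mathrm{GL}_n(k)$ be a continuous unramified representation of the form $\bar r=\bar r_1\oplus\bar r_2$ (block diagonal, with $\bar r_i:G_{F_v}\to\mathrm{GL}_{n_i}(k)$ and $n=n_1+n_2$) such that the characteristic polynomials $\det(X-\bar r_1(\mathrm{Frob}_v))$ and $\det(X-\bar r_2(\mathrm{Frob}_v))$ are relatively prime, where $\mathrm{Frob}_v$ is the geometric Frobenius. Let $A$ be a complete noetherian local $\mathcal O$-algebra with residue field $k$ whose maximal ideal $\mathfrak m_A$ is principal, with its $\mathfrak m_A$-adic topology. A lift of a representation $\bar s:G_{F_v}\to\mathrm{GL}_m(k)$ to $A$ is a continuous homomorphism $G_{F_v}\to\mathrm{GL}_m(A)$ whose reduction modulo $\mathfrak m_A$ is $\bar s$. Then for every lift $r:G_{F_v}\to\mathrm{GL}_n(A)$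 of $\bar r$ there are a matrix $X\in 1+M_n(\mathfrak m_A)$ and lifts $r_1$, $r_2$ to $A$ of $\bar r_1$, $\bar r_2$ respectively such that $X\,r(\sigma)\,X^{-1}=r_1(\sigma)\oplus r_2(\sigma)$ for all $\sigma\in G_{F_v}$. -/

import Mathlib

open IsDedekindDomain NumberField Polynomial
open scoped MatrixGroups

noncomputable section

/-- The valuation ring `𝒪` of a subfield `E` of `ℚ̄_p`. -/
abbrev padicValuationRing (p : ℕ) [Fact p.Prime] (E : IntermediateField ℚ_[p] (PadicAlgCl p)) :
    ValuationSubring E :=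
  (PadicAlgCl.valued p).v.valuationSubring.comap (algebraMap E (PadicAlgCl p))

/-- The residue field `k` of the valuation ring of a subfield `E` of `ℚ̄_p`. -/
abbrev padicResidueField (p : ℕ) [Fact p.Prime] (E : IntermediateField ℚ_[p] (PadicAlgCl p)) :
    Type :=
  IsLocalRing.ResidueField (padicValuationRing p E)

section LocalGalois

/-- The absolute Galois group of `K`, with the Krull topology. -/
abbrev LocalGalois (K : Type*) [Field K] : Type _ :=
  Gal(AlgebraicClosure K / K)

/-- The inertia subgroup of the absolute Galois group of a (complete) nonarchimedean field `K`: the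
automorphisms acting trivially on the residue field of `K̄`. Here `spectralNorm` is the unique
extension of the absolute value of `K` to `K̄`. -/
def inertiaGroup (K : Type*) [NormedField K] [IsUltrametricDist K] : Subgroup (LocalGalois K) where
  carrier := {σ | ∀ x : AlgebraicClosure K, spectralNorm K (AlgebraicClosure K) x ≤ 1 →
    spectralNorm K (AlgebraicClosure K) (σ x - x) < 1}
  one_mem' := by
    intro x _
    simp [spectralNorm_zero]
  mul_mem' := by
    intro σ τ hσ hτ x hx
    have h1 : spectralNorm K (AlgebraicClosure K) (τ x) ≤ 1 := by
      rwa [← spectralNorm_eq_of_equiv τ x]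
    have h2 := hσ (τ x) h1
    have h3 := hτ x hx
    have h4 : (σ * τ) x - x = (σ (τ x) - τ x) + (τ x - x) := by
      rw [AlgEquiv.mul_apply]; ring
    rw [h4]
    exact lt_of_le_of_lt (isNonarchimedean_spectralNorm _ _) (max_lt h2 h3)
  inv_mem' := by
    intro σ hσ x hx
    have h1 : spectralNorm K (AlgebraicClosure K) (σ⁻¹ x) ≤ 1 := by
      rwa [← spectralNorm_eq_of_equiv σ⁻¹ x]
    have h2 := hσ (σ⁻¹ x) h1
    have h3 : σ (σ⁻¹ x) = x := by
      rw [← AlgEquiv.mul_apply, mul_inv_cancel, AlgEquiv.one_apply]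
    rw [h3, ← spectralNorm_neg (Algebra.IsAlgebraic.isAlgebraic _), neg_sub] at h2
    exact h2

/-- `φ` is a lift to the absolute Galois group of the geometric Frobenius: its inverse acts on the
residue field of `K̄` as `x ↦ x ^ q`, where `q` is the order of the residue field of `K`. -/
def IsGeometricFrobenius (K : Type*) [NormedField K] (q : ℕ) (φ : LocalGalois K) : Prop :=
  ∀ x : AlgebraicClosure K, spectralNorm K (AlgebraicClosure K) x ≤ 1 →
    spectralNorm K (AlgebraicClosure K) (φ⁻¹ x - x ^ q) < 1

/-- A representation is unramified if it is trivial on inertia. -/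
def IsUnramifiedRep {K : Type*} [NormedField K] [IsUltrametricDist K] {H : Type*} [Group H]
    (ρ : LocalGalois K →* H) : Prop :=
  ∀ σ ∈ inertiaGroup K, ρ σ = 1

end LocalGalois

section Representations

variable {G : Type*} [Group G] {m m₁ m₂ : Type*} [Fintype m] [DecidableEq m]
  [Fintype m₁] [DecidableEq m₁] [Fintype m₂] [DecidableEq m₂]

/-- Block diagonal embedding `GL_{m₁} × GL_{m₂} → GL_{m₁ + m₂}`. -/
def blockDiagGL (R : Type*) [CommRing R] : GL m₁ R × GL m₂ R →* GL (m₁ ⊕ m₂) R where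
  toFun g :=
    { val := Matrix.fromBlocks (g.1 : Matrix m₁ m₁ R) 0 0 (g.2 : Matrix m₂ m₂ R)
      inv := Matrix.fromBlocks ((g.1⁻¹ : GL m₁ R) : Matrix m₁ m₁ R) 0 0
        ((g.2⁻¹ : GL m₂ R) : Matrix m₂ m₂ R)
      val_inv := by
        rw [Matrix.fromBlocks_multiply]
        simp only [Matrix.zero_mul, Matrix.mul_zero, add_zero, zero_add, Units.mul_inv]
        exact Matrix.fromBlocks_one
      inv_val := by
        rw [Matrix.fromBlocks_multiply]
        simp only [Matrix.zero_mul, Matrix.mul_zero, add_zero, zero_add, Units.inv_mul]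
        exact Matrix.fromBlocks_one }
  map_one' := by
    ext1
    exact Matrix.fromBlocks_one
  map_mul' g h := by
    ext1
    simp [Matrix.fromBlocks_multiply]

/-- The direct sum of two matrix representations. -/
def directSumRep {R : Type*} [CommRing R] (ρ₁ : G →* GL m₁ R) (ρ₂ : G →* GL m₂ R) :
    G →* GL (m₁ ⊕ m₂) R :=
  (blockDiagGL R).comp (ρ₁.prod ρ₂)

/-- `ρ : G → GL_m(A)` is a lift of `ρbar : G → GL_m(k)`, where `k → A / 𝔪_A` is the given
identification: `ρ` is a continuous homomorphism whose reduction modulo `𝔪_A` is `ρbar`. -/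
def IsLift [TopologicalSpace G] {k A : Type*} [CommRing k] [CommRing A] [IsLocalRing A]
    [TopologicalSpace A] [Algebra k (IsLocalRing.ResidueField A)]
    (ρbar : G →* GL m k) (ρ : G →* GL m A) : Prop :=
  Continuous ρ ∧
    (Matrix.GeneralLinearGroup.map (n := m) (IsLocalRing.residue A)).comp ρ =
      (Matrix.GeneralLinearGroup.map (n := m)
        (algebraMap k (IsLocalRing.ResidueField A))).comp ρbar

end Representations

end

/-! Since `q_v = 1` in `k`, the residue characteristic of `v` is not `p`, and a geometric Frobenius
`φ` fixes the `p`-th roots of unity. The maximal pro-`p` quotient of inertia is `ℤ_p(1)`, on which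
Frobenius acts trivially modulo `p`; so a homomorphism with open kernel from inertia to an
`𝔽_p`-vector space is unchanged by conjugation by `φ` (`monoidHom_inertiaGroup_conj`). This is
derived from Kummer theory, without the structure of tame inertia.

Coprimality of the characteristic polynomials makes the block idempotent `e₀` a polynomial in
Frobenius modulo `𝔪_A`. Lifting idempotents and conjugating by a matrix congruent to `1` makes
`s(φ)` commute with `e₀`, where `s` is the conjugate of `r` (`IsLocalRing.exists_conj_mul_comm`).

For the off-diagonal part `b(σ) = e₀ s(σ) (1 - e₀)` on inertia, suppose `b ≡ 0` modulo `𝔪^k`. Modulo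
`𝔪^(k+1)`, `b` is additive and killed by `p`, hence `φ`-invariant, so `s(φ)` commutes with `b(σ)`.
Then so does `Q(s(φ)) ≡ e₀`; but `e₀ b = b` and `b e₀ = 0`, whence `b ≡ 0` modulo `𝔪^(k+1)`
(`offDiagonal_mem_pow_succ`). In the limit `b = 0`, and symmetrically for the other block. The
elements whose image commutes with `e₀` form a closed subgroup containing inertia and `φ`, hence the
whole group (`eq_top_of_inertiaGroup_le_of_frobenius_mem`). -/

/-! ### Kummer theory for characters of prime order -/

section KummerTheory

variable {K L : Type*} [Field K] [Field L] [Algebra K L] [IsGalois K L]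

/-- Kummer theory: a character of prime order of a closed subgroup of a Galois group that fixes the
`p`-th roots of unity is given by the action of the group on a nonzero element. -/
theorem exists_ne_zero_forall_apply_eq_character_mul {p : ℕ} [hp : Fact p.Prime]
    (I : Subgroup Gal(L/K)) (hI : ∀ σ ∈ I, ∀ z : L, z ^ p = 1 → σ z = z)
    (χ : I →* Lˣ) (hχ : ∀ σ, χ σ ^ p = 1)
    (hker : IsClosed ((χ.ker.map I.subtype : Subgroup Gal(L/K)) : Set Gal(L/K))) :
    ∃ y : L, y ≠ 0 ∧ ∀ σ : I, (σ : Gal(L/K)) y = χ σ * y := by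
  by_cases htriv : ∀ σ, χ σ = 1
  · refine ⟨1, one_ne_zero, fun σ => by simp [htriv σ]⟩
  push Not at htriv
  obtain ⟨σ₀, hσ₀⟩ := htriv
  set ζ : Lˣ := χ σ₀ with hζ
  have hord : orderOf ζ = p := orderOf_eq_prime (hχ σ₀) hσ₀
  let N : ClosedSubgroup Gal(L/K) := ⟨χ.ker.map I.subtype, hker⟩
  let M := IntermediateField.fixedField (N : Subgroup Gal(L/K))
  have hNM : M.fixingSubgroup = (N : Subgroup Gal(L/K)) :=
    InfiniteGalois.fixingSubgroup_fixedField N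
  have hfixM : ∀ n : I, χ n = 1 → ∀ x : M, (n : Gal(L/K)) (x : L) = x := by
    intro n hn x
    exact x.2 ⟨n, ⟨n, hn, rfl⟩⟩
  -- The powers `σ₀ ^ i`, `i < p`, are distinct on the fixed field `M` of `ker χ`. Dedekind
  -- independence then gives a nonzero Lagrange resolvent `∑ ζ⁻ⁱ σ₀ⁱ(x)`, which is the required
  -- element.
  let g : Fin p → (M →* L) := fun i =>
    (((σ₀ : Gal(L/K)) ^ (i : ℕ) : Gal(L/K)) : L →* L).comp (M.val : M →* L)
  have hg : ∀ i x, g i x = ((σ₀ : Gal(L/K)) ^ (i : ℕ)) (x : L) := fun _ _ => rfl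
  have hginj : Function.Injective g := by
    intro i j hij
    have h1 : ((σ₀ : Gal(L/K)) ^ (i : ℕ))⁻¹ * (σ₀ : Gal(L/K)) ^ (j : ℕ) ∈
        (N : Subgroup Gal(L/K)) := by
      rw [← hNM, IntermediateField.mem_fixingSubgroup_iff]
      intro x hx
      have h2 := DFunLike.congr_fun hij ⟨x, hx⟩
      rw [hg, hg] at h2
      rw [AlgEquiv.mul_apply, ← h2, ← AlgEquiv.mul_apply, inv_mul_cancel, AlgEquiv.one_apply]
    obtain ⟨τ, hτ, hτ'⟩ := h1
    have h3 : τ = (σ₀ ^ (i : ℕ))⁻¹ * σ₀ ^ (j : ℕ) := Subtype.ext (by simpa using hτ')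
    have h4 : (ζ ^ (i : ℕ))⁻¹ * ζ ^ (j : ℕ) = 1 := by
      rw [hζ, ← map_pow, ← map_pow, ← map_inv, ← map_mul, ← h3]
      exact hτ
    have h5 : ζ ^ (i : ℕ) = ζ ^ (j : ℕ) := inv_mul_eq_one.mp h4
    rw [pow_inj_mod, hord, Nat.mod_eq_of_lt i.2, Nat.mod_eq_of_lt j.2] at h5
    exact Fin.ext h5
  have hli := (linearIndependent_monoidHom M L).comp g hginj
  rw [Fintype.linearIndependent_iff] at hli
  obtain ⟨x, hx⟩ : ∃ x : M, ∑ i : Fin p, ((ζ⁻¹ ^ (i : ℕ) : Lˣ) : L) * g i x ≠ 0 := by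
    by_contra! hcon
    have h0 := hli (fun i => ((ζ⁻¹ ^ (i : ℕ) : Lˣ) : L)) (by
      ext x
      simpa [Finset.sum_apply] using hcon x) ⟨0, hp.out.pos⟩
    exact Units.ne_zero _ h0
  have hζfix : ∀ σ : I, ∀ i : ℕ, (σ : Gal(L/K)) ((ζ⁻¹ ^ i : Lˣ) : L) = ((ζ⁻¹ ^ i : Lˣ) : L) := by
    intro σ i
    refine hI _ σ.2 _ ?_
    rw [← Units.val_pow_eq_pow_val, ← pow_mul, mul_comm, pow_mul, inv_pow, hζ, hχ]
    simp
  set f : ℕ → L := fun i => ((ζ⁻¹ ^ i : Lˣ) : L) * ((σ₀ : Gal(L/K)) ^ i) (x : L) with hf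
  have hy : ∑ i : Fin p, ((ζ⁻¹ ^ (i : ℕ) : Lˣ) : L) * g i x = ∑ i ∈ Finset.range p, f i := by
    rw [Finset.sum_range]; rfl
  rw [hy] at hx
  refine ⟨_, hx, ?_⟩
  have hstep : (σ₀ : Gal(L/K)) (∑ i ∈ Finset.range p, f i) =
      (ζ : L) * ∑ i ∈ Finset.range p, f i := by
    have h1 : ∀ i, (σ₀ : Gal(L/K)) (f i) = (ζ : L) * f (i + 1) := by
      intro i
      rw [hf]
      simp only
      rw [map_mul, hζfix, ← AlgEquiv.mul_apply, ← pow_succ', ← mul_assoc, ← Units.val_mul,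
        pow_succ' ζ⁻¹, mul_inv_cancel_left]
    have h2 : f p = f 0 := by
      have h3 := hfixM (σ₀ ^ p) (by rw [map_pow, hχ]) x
      have h4 : ζ⁻¹ ^ p = 1 := by rw [inv_pow, hζ, hχ, inv_one]
      rw [Subgroup.coe_pow] at h3
      simp only [hf, h3, h4, pow_zero, AlgEquiv.one_apply]
    rw [map_sum, Finset.sum_congr rfl (fun i _ => h1 i), ← Finset.mul_sum]
    congr 1
    have := Finset.sum_range_succ f p
    rw [Finset.sum_range_succ', h2] at this
    exact add_right_cancel this
  have hpow : ∀ i : ℕ, ((σ₀ : Gal(L/K)) ^ i) (∑ i ∈ Finset.range p, f i) =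
      ((ζ ^ i : Lˣ) : L) * ∑ i ∈ Finset.range p, f i := by
    intro i
    induction i with
    | zero => simp
    | succ i ih =>
      rw [pow_succ, AlgEquiv.mul_apply, hstep, map_mul, ih, pow_succ']
      have := hI _ (I.pow_mem σ₀.2 i) (ζ : L) (by rw [← Units.val_pow_eq_pow_val, hζ, hχ]; rfl)
      rw [this]; push_cast; ring
  have hN : ∀ n : I, χ n = 1 → (n : Gal(L/K)) (∑ i ∈ Finset.range p, f i) =
      ∑ i ∈ Finset.range p, f i := by
    intro n hn
    rw [map_sum]
    refine Finset.sum_congr rfl fun i _ => ?_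
    -- Normality of `ker χ`: `n` fixes `σ₀ ^ i x` because its conjugate fixes `x`.
    have h1 := hfixM ((σ₀ ^ i)⁻¹ * n * σ₀ ^ i) (by simp [hn]) x
    have h2 : (n : Gal(L/K)) (((σ₀ : Gal(L/K)) ^ i) (x : L)) = ((σ₀ : Gal(L/K)) ^ i) (x : L) := by
      conv_rhs => rw [← h1]
      simp only [Subgroup.coe_mul, Subgroup.coe_pow, Subgroup.coe_inv, ← AlgEquiv.mul_apply]
      congr 1
      group
    rw [hf]
    simp only
    rw [map_mul, hζfix, h2]
  intro τ
  -- The values of `χ` are powers of `ζ`, so `τ` lies in some coset `σ₀ ^ i * ker χ`.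
  have hprim : IsPrimitiveRoot ζ p := hord ▸ IsPrimitiveRoot.orderOf ζ
  obtain ⟨i, -, hi⟩ := (IsPrimitiveRoot.coe_units_iff.mpr hprim).eq_pow_of_pow_eq_one
    (ξ := (χ τ : L)) (by rw [← Units.val_pow_eq_pow_val, hχ]; rfl)
  replace hi : ζ ^ i = χ τ := Units.ext (by simpa using hi)
  have h1 := hN ((σ₀ ^ i)⁻¹ * τ) (by rw [map_mul, map_inv, map_pow, ← hζ, hi, inv_mul_cancel])
  have h2 := hpow i
  rw [← h1, ← AlgEquiv.mul_apply] at h2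
  rw [h1, hi] at h2
  rw [← h2]
  congr 1
  simp

end KummerTheory

/-! ### Roots of unity in ultrametric fields -/

section NormedField

variable {C : Type*} [NormedField C] [IsUltrametricDist C]

/-- A root of unity of order invertible in the residue field that reduces to `1` equals `1`. -/
theorem eq_one_of_pow_eq_one_of_norm_sub_one_lt_one {u : C} {n : ℕ} (hn : ‖(n : C)‖ = 1)
    (hu : u ^ n = 1) (h : ‖u - 1‖ < 1) : u = 1 := by
  by_contra hne
  have hle : ‖u‖ ≤ 1 := by
    have := IsUltrametricDist.norm_add_le_max (u - 1) 1
    rw [sub_add_cancel, norm_one] at this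
    exact this.trans (max_le h.le le_rfl)
  -- If `u ≠ 1` this sum vanishes, yet each term is congruent to `1`, so the sum is congruent to
  -- `n`, which has norm `1`.
  have h0 : ∑ i ∈ Finset.range n, u ^ i = 0 := by
    have h1 := mul_geom_sum u n
    rw [hu, sub_self] at h1
    exact (mul_eq_zero.mp h1).resolve_left (sub_ne_zero.mpr hne)
  have h2 : ∀ i : ℕ, ‖u ^ i - 1‖ < 1 := by
    intro i
    rw [← mul_geom_sum, norm_mul]
    refine lt_of_le_of_lt (mul_le_of_le_one_right (norm_nonneg _) ?_) h
    refine IsUltrametricDist.norm_sum_le_of_forall_le_of_nonneg zero_le_one fun j _ => ?_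
    rw [norm_pow]
    exact pow_le_one₀ (norm_nonneg _) hle
  have h3 : ‖∑ i ∈ Finset.range n, (u ^ i - 1)‖ < 1 := by
    obtain ⟨i, -, hi⟩ := IsUltrametricDist.exists_norm_finsetSum_le (Finset.range n)
      fun i => u ^ i - 1
    exact hi.trans_lt (h2 i)
  rw [Finset.sum_sub_distrib, h0, Finset.sum_const, Finset.card_range, zero_sub, norm_neg,
    nsmul_eq_mul, mul_one, hn] at h3
  exact lt_irrefl _ h3

end NormedField

/-! ### Conjugation invariance of `p`-torsion characters of inertia -/

section TameInertia

variable {K : Type*} [NontriviallyNormedField K] [IsUltrametricDist K]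

theorem conj_mem_inertiaGroup {σ : LocalGalois K} (hσ : σ ∈ inertiaGroup K) (φ : LocalGalois K) :
    φ * σ * φ⁻¹ ∈ inertiaGroup K := by
  intro x hx
  have h1 := hσ (φ⁻¹ x) (by rwa [← spectralNorm_eq_of_equiv φ⁻¹ x])
  rw [spectralNorm_eq_of_equiv φ, map_sub, ← AlgEquiv.mul_apply φ φ⁻¹, mul_inv_cancel] at h1
  exact h1

/-- The condition at each `x` depends only on `σ x`, so it is invariant under right translation by
the open stabilizer of `x`. -/
theorem isClosed_inertiaGroup : IsClosed (inertiaGroup K : Set (LocalGalois K)) := by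
  have : (inertiaGroup K : Set (LocalGalois K)) =
      ⋂ x : AlgebraicClosure K, {σ | spectralNorm K (AlgebraicClosure K) x ≤ 1 →
        spectralNorm K (AlgebraicClosure K) (σ x - x) < 1} := by
    ext σ
    simp only [Set.mem_iInter]
    rfl
  rw [this]
  refine isClosed_iInter fun x => ?_
  rw [← isOpen_compl_iff, isOpen_iff_mem_nhds]
  intro σ hσ
  have hopen := stabilizer_isOpen_of_isIntegral (K := K) x
  refine Filter.mem_of_superset ((hopen.leftCoset σ).mem_nhds ⟨1, one_mem _, mul_one σ⟩) ?_
  rintro _ ⟨τ, hτ, rfl⟩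
  have : τ x = x := hτ
  simpa [this] using hσ

variable [CompleteSpace K]

/-- The norm of `y` is a root of that of the constant term of its minimal polynomial. This allows a
power of a Kummer generator to be compared with an element of `K`. -/
theorem exists_norm_pow_spectralNorm_eq (y : AlgebraicClosure K) (hy : y ≠ 0) :
    ∃ (n : ℕ) (c : K), n ≠ 0 ∧ c ≠ 0 ∧ spectralNorm K (AlgebraicClosure K) y ^ n = ‖c‖ := by
  have hint : IsIntegral K y := Algebra.IsIntegral.isIntegral y
  have hn := (minpoly.natDegree_pos hint).ne'
  refine ⟨(minpoly K y).natDegree, (minpoly K y).coeff 0, hn, minpoly.coeff_zero_ne_zero hint hy, ?_⟩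
  rw [spectralNorm.spectralNorm_eq_norm_coeff_zero_rpow, ← Real.rpow_natCast, ← Real.rpow_mul
    (norm_nonneg _), one_div_mul_cancel (by exact_mod_cast hn), Real.rpow_one]

/-- A character of order `p` of inertia, where `p` is prime to the residue characteristic, is
invariant under conjugation by automorphisms fixing the `p`-th roots of unity. -/
theorem character_inertiaGroup_conj [CharZero K] {p : ℕ} [hp : Fact p.Prime]
    (hpK : ‖(p : K)‖ = 1) (φ : LocalGalois K)
    (hφ : ∀ z : AlgebraicClosure K, z ^ p = 1 → φ z = z)
    (χ : inertiaGroup K →* (AlgebraicClosure K)ˣ) (hχ : ∀ σ, χ σ ^ p = 1)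
    (hker : IsOpen (χ.ker : Set (inertiaGroup K))) (σ : inertiaGroup K) :
    χ ⟨φ * σ * φ⁻¹, conj_mem_inertiaGroup σ.2 φ⟩ = χ σ := by
  let _ : NormedField (AlgebraicClosure K) := spectralNorm.normedField K (AlgebraicClosure K)
  have hnorm : ∀ x : AlgebraicClosure K, ‖x‖ = spectralNorm K (AlgebraicClosure K) x :=
    fun _ => rfl
  have : IsUltrametricDist (AlgebraicClosure K) :=
    IsUltrametricDist.isUltrametricDist_of_forall_norm_add_le_max_norm
      (isNonarchimedean_spectralNorm (K := K) (L := AlgebraicClosure K))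
  have hpL : ∀ s : ℕ, ‖((p ^ s : ℕ) : AlgebraicClosure K)‖ = 1 := by
    intro s
    rw [Nat.cast_pow, norm_pow, hnorm, ← map_natCast (algebraMap K (AlgebraicClosure K)),
      spectralNorm_extends, hpK, one_pow]
  have hmem : ∀ τ ∈ inertiaGroup K, ∀ x : AlgebraicClosure K, ‖x‖ ≤ 1 → ‖τ x - x‖ < 1 :=
    fun τ hτ => hτ
  have hone : ∀ τ ∈ inertiaGroup K, ∀ x : AlgebraicClosure K, ∀ s : ℕ, ‖x‖ = 1 →
      (τ x / x) ^ p ^ s = 1 → τ x = x := by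
    intro τ hτ x s hx hpow
    have hx0 : x ≠ 0 := norm_ne_zero_iff.mp (by rw [hx]; exact one_ne_zero)
    have := eq_one_of_pow_eq_one_of_norm_sub_one_lt_one (hpL s) hpow (by
      rw [div_sub_one hx0, norm_div, hx, div_one]
      exact hmem τ hτ x hx.le)
    exact (div_eq_one_iff_eq hx0).mp this
  have hroots : ∀ τ ∈ inertiaGroup K, ∀ x : AlgebraicClosure K, ∀ s : ℕ, x ^ p ^ s = 1 →
      τ x = x := by
    intro τ hτ x s hx
    refine hone τ hτ x s ?_ ?_
    · have h1 : ‖x‖ ^ p ^ s = 1 := by rw [← norm_pow, hx, norm_one]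
      exact (pow_eq_one_iff_of_nonneg (norm_nonneg _) (pow_ne_zero _ hp.out.ne_zero)).mp h1
    · rw [div_pow, ← map_pow, hx, map_one, div_one]
  obtain ⟨y, hy0, hy⟩ := exists_ne_zero_forall_apply_eq_character_mul (inertiaGroup K)
    (fun τ hτ z hz => hroots τ hτ z 1 (by simpa using hz)) χ hχ (by
      have h1 := isClosed_inertiaGroup (K := K)
      have h2 : IsClosed (χ.ker : Set (inertiaGroup K)) := Subgroup.isClosed_of_isOpen _ hker
      exact h1.isClosedEmbedding_subtypeVal.isClosedMap _ h2)
  obtain ⟨n, c, hn, hc, hyn⟩ := exists_norm_pow_spectralNorm_eq y hy0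
  -- The prime-to-`p` part `b` of the exponent is harmless for characters of order `p`. A `p ^ s`-th
  -- root `w` of `c` has the norm of `y ^ b`, so `y ^ b / w` is a unit.
  obtain ⟨s, b, hb, rfl⟩ := Nat.exists_eq_pow_mul_and_not_dvd hn p hp.out.ne_one
  obtain ⟨w, hw⟩ := IsAlgClosed.exists_pow_nat_eq (algebraMap K (AlgebraicClosure K) c)
    (pow_pos hp.out.pos s)
  have hc' : algebraMap K (AlgebraicClosure K) c ≠ 0 := by simpa using hc
  have hw0 : w ≠ 0 := by
    rintro rfl
    rw [zero_pow (pow_ne_zero _ hp.out.ne_zero)] at hw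
    exact hc' hw.symm
  have hwroot : ∀ τ : LocalGalois K, (τ w / w) ^ p ^ s = 1 := by
    intro τ
    rw [div_pow, ← map_pow, hw, AlgEquiv.commutes, div_self hc']
  have ht : ‖y ^ b / w‖ = 1 := by
    have h1 : ‖y ^ b / w‖ ^ p ^ s = 1 := by
      rw [← norm_pow, div_pow, hw, ← pow_mul, norm_div, norm_pow, mul_comm b, hnorm y, hyn,
        hnorm (algebraMap _ _ c), spectralNorm_extends, div_self (norm_ne_zero_iff.mpr hc)]
    exact (pow_eq_one_iff_of_nonneg (norm_nonneg _) (pow_ne_zero _ hp.out.ne_zero)).mp h1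
  -- On the unit `y ^ b / w`, inertia acts through a `p ^ (s + 1)`-th root of unity reducing to `1`,
  -- hence trivially. So `χ ^ b` is the Kummer character of `w`.
  have hkey : ∀ τ : inertiaGroup K, ((χ τ ^ b : (AlgebraicClosure K)ˣ) : AlgebraicClosure K) =
      (τ : LocalGalois K) w / w := by
    intro τ
    have hwτ : (τ : LocalGalois K) w ≠ 0 := by simpa using hw0
    have h1 : (τ : LocalGalois K) (y ^ b / w) / (y ^ b / w) =
        ((χ τ ^ b : (AlgebraicClosure K)ˣ) : AlgebraicClosure K) / ((τ : LocalGalois K) w / w) := by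
      rw [map_div₀, map_pow, hy τ]
      push_cast
      field_simp
      ring
    have h2 := hone τ τ.2 (y ^ b / w) (s + 1) ht (by
      have h3 : (χ τ ^ b) ^ p ^ (s + 1) = 1 := by
        rw [← pow_mul, pow_succ, ← mul_assoc, mul_comm _ p, pow_mul, hχ, one_pow]
      rw [h1, div_pow, ← Units.val_pow_eq_pow_val, h3, pow_succ, pow_mul ((τ : LocalGalois K) w / w),
        hwroot, one_pow, Units.val_one, div_one])
    rw [h2, div_self (by rw [← norm_ne_zero_iff, ht]; exact one_ne_zero)] at h1
    exact (div_eq_one_iff_eq (div_ne_zero hwτ hw0)).mp h1.symm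
  have hb' : χ ⟨φ * σ * φ⁻¹, conj_mem_inertiaGroup σ.2 φ⟩ ^ b = χ σ ^ b := by
    apply Units.ext
    have hfix : φ ((χ σ ^ b : (AlgebraicClosure K)ˣ) : AlgebraicClosure K) =
        ((χ σ ^ b : (AlgebraicClosure K)ˣ) : AlgebraicClosure K) := by
      apply hφ
      rw [← Units.val_pow_eq_pow_val, ← pow_mul, mul_comm, pow_mul, hχ]
      simp
    rw [hkey, ← hfix, hkey]
    -- Since `w ^ p ^ s` lies in `K`, the ratio `φ⁻¹ w / w` is a `p ^ s`-th root of unity, fixed by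
    -- inertia; it cancels from the conjugated character.
    have h1 : φ⁻¹ w = (φ⁻¹ w / w) * w := (div_mul_cancel₀ _ hw0).symm
    have h2 : (σ : LocalGalois K) (φ⁻¹ w) = (φ⁻¹ w / w) * (σ : LocalGalois K) w := by
      conv_lhs => rw [h1]
      rw [map_mul, hroots σ σ.2 _ s (hwroot φ⁻¹)]
    have h3 : φ (φ⁻¹ w) = w := by rw [← AlgEquiv.mul_apply, mul_inv_cancel, AlgEquiv.one_apply]
    have h4 : φ w ≠ 0 := by simpa using hw0
    change φ ((σ : LocalGalois K) (φ⁻¹ w)) / w = _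
    rw [h2, map_mul, map_div₀, map_div₀, h3]
    field_simp
  have hcop : Nat.Coprime p b := (Nat.Prime.coprime_iff_not_dvd hp.out).mpr hb
  -- The quotient is killed by the coprime exponents `p` and `b`.
  have hsub : (χ ⟨φ * σ * φ⁻¹, conj_mem_inertiaGroup σ.2 φ⟩ / χ σ) = 1 := by
    have h1 : (χ ⟨φ * σ * φ⁻¹, conj_mem_inertiaGroup σ.2 φ⟩ / χ σ) ^ p = 1 := by
      rw [div_pow, hχ, hχ, div_one]
    have h2 : (χ ⟨φ * σ * φ⁻¹, conj_mem_inertiaGroup σ.2 φ⟩ / χ σ) ^ b = 1 := by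
      rw [div_pow, hb', div_self']
    have h3 := pow_gcd_eq_one.mpr ⟨h1, h2⟩
    rwa [hcop.gcd_eq_one, pow_one] at h3
  exact div_eq_one.mp hsub

/-- A homomorphism from inertia to an elementary abelian `p`-group, where `p` is prime to the
residue characteristic, is invariant under conjugation by automorphisms fixing the `p`-th roots of
unity. -/
theorem monoidHom_inertiaGroup_conj [CharZero K] {p : ℕ} [hp : Fact p.Prime]
    (hpK : ‖(p : K)‖ = 1) (φ : LocalGalois K)
    (hφ : ∀ z : AlgebraicClosure K, z ^ p = 1 → φ z = z)
    {V : Type*} [AddCommGroup V] (hV : ∀ v : V, p • v = 0)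
    (f : inertiaGroup K →* Multiplicative V)
    (hker : IsOpen (f.ker : Set (inertiaGroup K))) (σ : inertiaGroup K) :
    f ⟨φ * σ * φ⁻¹, conj_mem_inertiaGroup σ.2 φ⟩ = f σ := by
  have i : Module (ZMod p) V := AddCommGroup.zmodModule hV
  obtain ⟨ζ, hζ⟩ := HasEnoughRootsOfUnity.exists_primitiveRoot (AlgebraicClosure K) p
  replace hζ : IsPrimitiveRoot (hζ.isUnit hp.out.ne_zero).unit p :=
    IsPrimitiveRoot.coe_units_iff.mp (by simpa using hζ)
  set z := (hζ.isUnit hp.out.ne_zero).unit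
  let ψ : Multiplicative (ZMod p) →* (AlgebraicClosure K)ˣ := (Subgroup.subtype _).comp
    (AddMonoidHom.toMultiplicativeLeft hζ.zmodEquivZPowers.toAddMonoidHom)
  have hψ : Function.Injective ψ := fun a b hab =>
    hζ.zmodEquivZPowers.injective (Subtype.ext hab)
  rw [← div_eq_one, ← toAdd_eq_zero]
  -- Linear functionals separate the points of an `𝔽_p`-vector space; composing with `ψ`, which
  -- identifies `ℤ/p` with the `p`-th roots of unity, reduces to characters.
  refine (Module.forall_dual_apply_eq_zero_iff (ZMod p) _).mp fun g => ?_
  let χ : inertiaGroup K →* (AlgebraicClosure K)ˣ :=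
    (ψ.comp (AddMonoidHom.toMultiplicative g.toAddMonoidHom)).comp f
  have hle : f.ker ≤ χ.ker := by
    intro τ hτ
    rw [MonoidHom.mem_ker] at hτ ⊢
    simp [χ, hτ]
  have h1 := character_inertiaGroup_conj hpK φ hφ χ (fun τ => by
    rw [← map_pow]
    have : f (τ ^ p) = 1 := by rw [map_pow]; exact hV (f τ).toAdd
    exact hle this) (Subgroup.isOpen_mono hle hker) σ
  have h2 := hψ h1
  rw [toAdd_div, map_sub, sub_eq_zero]
  exact h2

end TameInertia

/-! ### The residue characteristic differs from `p` -/

section ResidueCharacteristic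

variable {K : Type*} [NormedField K]

theorem norm_card_residueField_lt_one (O : ValuationSubring K)
    (hO : ∀ x : K, x ∈ O ↔ ‖x‖ ≤ 1) :
    ‖(Nat.card (IsLocalRing.ResidueField O) : K)‖ < 1 := by
  have hq : (Nat.card (IsLocalRing.ResidueField O) : IsLocalRing.ResidueField O) = 0 := by
    rcases finite_or_infinite (IsLocalRing.ResidueField O) with h | h
    · have := Fintype.ofFinite (IsLocalRing.ResidueField O)
      rw [Nat.card_eq_fintype_card, FiniteField.cast_card_eq_zero]
    -- For an infinite residue field `Nat.card` is `0`.
    · simp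
  have h2 : (Nat.card (IsLocalRing.ResidueField O) : O) ∈ IsLocalRing.maximalIdeal O := by
    rw [← IsLocalRing.residue_eq_zero_iff, map_natCast, hq]
  have h3 : ‖(Nat.card (IsLocalRing.ResidueField O) : K)‖ ≤ 1 :=
    (hO _).mp (natCast_mem O _)
  refine lt_of_le_of_ne h3 fun h1 => ?_
  have h0 : (Nat.card (IsLocalRing.ResidueField O) : K) ≠ 0 :=
    norm_ne_zero_iff.mp (by rw [h1]; exact one_ne_zero)
  refine h2 (IsUnit.of_mul_eq_one ⟨(Nat.card (IsLocalRing.ResidueField O) : K)⁻¹, (hO _).mpr ?_⟩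
    (Subtype.ext ?_))
  · rw [norm_inv, h1, inv_one]
  · simpa using mul_inv_cancel₀ h0

/-- Writing `1 = (p * m + 1) - p * m` shows that `p` and `p * m + 1` cannot both have norm less than
`1`. Applied with `p * m + 1` the order of the residue field. -/
theorem norm_eq_one_of_norm_add_one_lt_one [IsUltrametricDist K] {p m : ℕ} (h : ‖((p * m + 1 : ℕ) : K)‖ < 1) :
    ‖(p : K)‖ = 1 := by
  refine le_antisymm (IsUltrametricDist.norm_natCast_le_one K p) (not_lt.mp fun hp => ?_)
  have h1 : (1 : K) = ((p * m + 1 : ℕ) : K) - (p : K) * m := by push_cast; ring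
  have h2 : ‖(1 : K)‖ < 1 := by
    rw [h1, sub_eq_add_neg]
    refine (IsUltrametricDist.norm_add_le_max _ _).trans_lt (max_lt h ?_)
    rw [norm_neg, norm_mul]
    exact (mul_le_of_le_one_right (norm_nonneg _)
      (IsUltrametricDist.norm_natCast_le_one K m)).trans_lt hp
  rw [norm_one] at h2
  exact lt_irrefl _ h2

end ResidueCharacteristic

/-! ### Inertia and Frobenius generate topologically -/

section Density

variable {K : Type*} [NontriviallyNormedField K] [IsUltrametricDist K] [CompleteSpace K]

variable (K) in
/-- The ring of integers of the algebraic closure of `K`. -/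
def algClosureIntegers : Subring (AlgebraicClosure K) where
  carrier := {x | spectralNorm K (AlgebraicClosure K) x ≤ 1}
  one_mem' := (spectralNorm_one (K := K) (L := AlgebraicClosure K)).le
  zero_mem' := (spectralNorm_zero (K := K) (L := AlgebraicClosure K)).trans_le zero_le_one
  mul_mem' {x y} hx hy := by
    have := map_mul (spectralMulAlgNorm K (AlgebraicClosure K)) x y
    simp only [spectralMulAlgNorm_def] at this
    exact this.trans_le (mul_le_one₀ hx (spectralNorm_nonneg y) hy)
  add_mem' {x y} hx hy :=
    (isNonarchimedean_spectralNorm (K := K) (L := AlgebraicClosure K) x y).trans (max_le hx hy)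
  neg_mem' {x} hx := by
    change spectralNorm K (AlgebraicClosure K) (-x) ≤ 1
    rwa [spectralNorm_neg (Algebra.IsAlgebraic.isAlgebraic x)]

theorem mem_algClosureIntegers {x : AlgebraicClosure K} :
    x ∈ algClosureIntegers K ↔ spectralNorm K (AlgebraicClosure K) x ≤ 1 := Iff.rfl

variable (K) in
/-- The maximal ideal of the ring of integers of the algebraic closure of `K`. -/
def algClosureMaximalIdeal : Ideal (algClosureIntegers K) where
  carrier := {x | spectralNorm K (AlgebraicClosure K) x < 1}
  zero_mem' := (spectralNorm_zero (K := K) (L := AlgebraicClosure K)).trans_lt zero_lt_one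
  add_mem' {x y} hx hy :=
    (isNonarchimedean_spectralNorm (K := K) (L := AlgebraicClosure K) x y).trans_lt (max_lt hx hy)
  smul_mem' a x hx := by
    have := map_mul (spectralMulAlgNorm K (AlgebraicClosure K)) (a : AlgebraicClosure K) x
    simp only [spectralMulAlgNorm_def] at this
    exact this.trans_lt (lt_of_le_of_lt
      (mul_le_of_le_one_left (spectralNorm_nonneg _) a.2) hx)

theorem mem_algClosureMaximalIdeal {x : algClosureIntegers K} :
    x ∈ algClosureMaximalIdeal K ↔ spectralNorm K (AlgebraicClosure K) x < 1 := Iff.rfl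

instance : (algClosureMaximalIdeal K).IsPrime where
  ne_top' := by
    rw [Ne, Ideal.eq_top_iff_one, mem_algClosureMaximalIdeal]
    simp [spectralNorm_one]
  mem_or_mem' {x y} hxy := by
    have := map_mul (spectralMulAlgNorm K (AlgebraicClosure K)) (x : AlgebraicClosure K) y
    simp only [spectralMulAlgNorm_def] at this
    rw [mem_algClosureMaximalIdeal] at hxy ⊢
    rw [mem_algClosureMaximalIdeal]
    by_contra! h
    rw [Subring.coe_mul, this] at hxy
    exact hxy.not_ge (one_le_mul_of_one_le_of_one_le h.1 h.2)

noncomputable instance : MulSemiringAction (LocalGalois K) (algClosureIntegers K) where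
  smul σ x := ⟨σ x, by
    rw [mem_algClosureIntegers, ← spectralNorm_eq_of_equiv σ]; exact x.2⟩
  one_smul _ := rfl
  mul_smul _ _ _ := rfl
  smul_zero σ := Subtype.ext (map_zero σ)
  smul_one σ := Subtype.ext (map_one σ)
  smul_add σ x y := Subtype.ext (map_add σ (x : AlgebraicClosure K) y)
  smul_mul σ x y := Subtype.ext (map_mul σ (x : AlgebraicClosure K) y)

theorem coe_smul_algClosureIntegers (σ : LocalGalois K) (x : algClosureIntegers K) :
    ((σ • x : algClosureIntegers K) : AlgebraicClosure K) = σ x := rfl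

theorem mem_inertiaGroup_iff {σ : LocalGalois K} :
    σ ∈ inertiaGroup K ↔ ∀ x : algClosureIntegers K, σ • x - x ∈ algClosureMaximalIdeal K :=
  ⟨fun h x => h x x.2, fun h x hx => h ⟨x, hx⟩⟩

theorem smul_mem_algClosureMaximalIdeal_iff (σ : LocalGalois K) {x : algClosureIntegers K} :
    σ • x ∈ algClosureMaximalIdeal K ↔ x ∈ algClosureMaximalIdeal K := by
  rw [mem_algClosureMaximalIdeal, mem_algClosureMaximalIdeal, coe_smul_algClosureIntegers,
    ← spectralNorm_eq_of_equiv σ]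

/-- The absolute Galois group of `K` is topologically generated by inertia and a lift of the
geometric Frobenius. -/
theorem eq_top_of_inertiaGroup_le_of_frobenius_mem [CharZero K] {q : ℕ}
    (hK : ∀ x : algClosureIntegers K, x ^ q - x ∈ algClosureMaximalIdeal K →
      ∃ (c : K) (hc : algebraMap K (AlgebraicClosure K) c ∈ algClosureIntegers K),
        x - ⟨_, hc⟩ ∈ algClosureMaximalIdeal K)
    {φ : LocalGalois K} (hφ : IsGeometricFrobenius K q φ) (H : Subgroup (LocalGalois K))
    (hclosed : IsClosed (H : Set (LocalGalois K))) (hI : inertiaGroup K ≤ H) (hφH : φ ∈ H) :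
    H = ⊤ := by
  let B := algClosureIntegers K
  let Q := algClosureMaximalIdeal K
  let A := FixedPoints.subring B H
  let P : Ideal A := Q.under A
  have : CompactSpace H := isCompact_iff_compactSpace.mp hclosed.isCompact
  -- With the discrete topology on `B`, continuity of the action amounts to openness of stabilizers.
  let _ : TopologicalSpace B := ⊥
  have : DiscreteTopology B := ⟨rfl⟩
  have : ContinuousSMul H B := by
    refine ⟨continuous_def.mpr fun s _ => ?_⟩
    rw [isOpen_iff_mem_nhds]
    rintro ⟨h, b⟩ hb
    have hopen := (stabilizer_isOpen_of_isIntegral (K := K) (b : AlgebraicClosure K)).leftCoset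
      (h : LocalGalois K)
    refine mem_nhds_prod_iff.mpr ⟨Subtype.val ⁻¹' _,
      (hopen.preimage continuous_subtype_val).mem_nhds ⟨1, one_mem _, mul_one _⟩, {b},
      (isOpen_discrete _).mem_nhds rfl, ?_⟩
    rintro ⟨h', b'⟩ ⟨⟨τ, hτ, hτ'⟩, hb'⟩
    have hbb : b' = b := hb'
    have : h' • b' = h • b := by
      rw [hbb]
      apply Subtype.ext
      change (h' : LocalGalois K) (b : AlgebraicClosure K) = (h : LocalGalois K) b
      rw [← hτ']
      exact congrArg (h : LocalGalois K) hτ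
    simpa [this] using hb
  have : SMulCommClass H A B := ⟨fun h a b => by
    have : h • (a : B) = a := a.2 h
    rw [Subring.smul_def, Subring.smul_def, smul_eq_mul, smul_mul', this, smul_eq_mul]⟩
  have : Algebra.IsInvariant A B H := ⟨fun b hb => ⟨⟨b, hb⟩, rfl⟩⟩
  -- An `H`-invariant `a` is fixed by `φ⁻¹`, so `a ^ q ≡ a`. Thus `a` is congruent to an element of
  -- `K`, and every `σ` fixes its residue class.
  have hfixed : ∀ (a : A) (σ : LocalGalois K), σ • (a : B) - a ∈ Q := by
    intro a σ
    have h1 : (φ⁻¹ • (a : B)) = a := a.2 ⟨φ⁻¹, inv_mem hφH⟩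
    have h2 : (a : B) ^ q - a ∈ Q := by
      have h3 : φ⁻¹ • (a : B) - (a : B) ^ q ∈ Q := hφ a (a : B).2
      rw [h1] at h3
      rw [← neg_sub]
      exact neg_mem h3
    obtain ⟨c, hc, hac⟩ := hK a h2
    have h4 : σ • (⟨_, hc⟩ : B) = ⟨_, hc⟩ := Subtype.ext (σ.commutes c)
    have h5 := (smul_mem_algClosureMaximalIdeal_iff σ).mpr hac
    rw [smul_sub, h4] at h5
    have := sub_mem h5 hac
    rwa [sub_sub_sub_cancel_right] at this
  have hstab : ∀ σ : LocalGalois K, Q = Q.map (MulSemiringAction.toRingEquiv _ B σ : B →+* B) := by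
    intro σ
    ext x
    rw [Ideal.mem_map_iff_of_surjective ((MulSemiringAction.toRingEquiv _ B σ : B ≃+* B) : B →+* B)
      (MulSemiringAction.toRingEquiv _ B σ).surjective]
    constructor
    · intro hx
      exact ⟨σ⁻¹ • x, (smul_mem_algClosureMaximalIdeal_iff _).mpr hx, smul_inv_smul σ x⟩
    · rintro ⟨y, hy, rfl⟩
      exact (smul_mem_algClosureMaximalIdeal_iff σ).mpr hy
  rw [eq_top_iff]
  intro σ _
  -- Hence `σ` induces an automorphism of `B ⧸ Q` over `A ⧸ P`. For the profinite group `H` such an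
  -- automorphism comes from some `h` in `H`, and `h⁻¹ σ` is then inertial.
  let e : (B ⧸ Q) ≃ₐ[A ⧸ P] (B ⧸ Q) := AlgEquiv.ofRingEquiv
    (f := Ideal.quotientEquiv Q Q (MulSemiringAction.toRingEquiv _ B σ) (hstab σ)) (by
      intro x
      obtain ⟨a, rfl⟩ := Ideal.Quotient.mk_surjective x
      exact Ideal.Quotient.eq.mpr (hfixed a σ))
  obtain ⟨h, hh⟩ := Ideal.Quotient.stabilizerHom_surjective_of_profinite (G := H) P Q e
  have hmem : (h.1 : LocalGalois K)⁻¹ * σ ∈ inertiaGroup K := by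
    rw [mem_inertiaGroup_iff]
    intro x
    have h1 := DFunLike.congr_fun hh (Ideal.Quotient.mk Q x)
    have h2 : (h.1 : LocalGalois K) • x - σ • x ∈ Q := Ideal.Quotient.eq.mp h1
    rw [← smul_mem_algClosureMaximalIdeal_iff (h.1 : LocalGalois K), smul_sub, smul_smul,
      mul_inv_cancel_left, ← neg_sub]
    exact neg_mem h2
  have := H.mul_mem h.1.2 (hI hmem)
  rwa [mul_inv_cancel_left] at this

/-- If the residue field of `K` has `q` elements, then every integer of the algebraic closure
satisfying `x ^ q ≡ x` is congruent to an element of `K`. -/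
theorem exists_sub_mem_algClosureMaximalIdeal_of_pow_card (O : ValuationSubring K)
    (hO : ∀ x : K, x ∈ O ↔ ‖x‖ ≤ 1) [Finite (IsLocalRing.ResidueField O)]
    (x : algClosureIntegers K)
    (hx : x ^ Nat.card (IsLocalRing.ResidueField O) - x ∈ algClosureMaximalIdeal K) :
    ∃ (c : K) (hc : algebraMap K (AlgebraicClosure K) c ∈ algClosureIntegers K),
      x - ⟨_, hc⟩ ∈ algClosureMaximalIdeal K := by
  have hmem : ∀ c : O, algebraMap K (AlgebraicClosure K) c ∈ algClosureIntegers K := by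
    intro c
    rw [mem_algClosureIntegers, spectralNorm_extends]
    exact (hO c).mp c.2
  let ι : O →+* algClosureIntegers K :=
    ((algebraMap K (AlgebraicClosure K)).comp O.subtype).codRestrict _ hmem
  let π := Ideal.Quotient.mk (algClosureMaximalIdeal K)
  let j : IsLocalRing.ResidueField O →+* (algClosureIntegers K ⧸ algClosureMaximalIdeal K) :=
    Ideal.Quotient.lift _ (π.comp ι) (by
      intro c hc
      refine Ideal.Quotient.eq_zero_iff_mem.mpr ?_
      rw [mem_algClosureMaximalIdeal]
      change spectralNorm K _ (algebraMap K _ (c : K)) < 1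
      rw [spectralNorm_extends]
      refine lt_of_le_of_ne ((hO c).mp c.2) fun h1 => ?_
      have h0 : (c : K) ≠ 0 := norm_ne_zero_iff.mp (by rw [h1]; exact one_ne_zero)
      refine hc (IsUnit.of_mul_eq_one ⟨(c : K)⁻¹, (hO _).mpr ?_⟩ (Subtype.ext (mul_inv_cancel₀ h0)))
      rw [norm_inv, h1, inv_one])
  have := Fintype.ofFinite (IsLocalRing.ResidueField O)
  have hprod : ∏ a : IsLocalRing.ResidueField O, (X - C a) =
      X ^ Nat.card (IsLocalRing.ResidueField O) - X := by
    rw [Nat.card_eq_fintype_card]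
    have h1 := FiniteField.roots_X_pow_card_sub_X (IsLocalRing.ResidueField O)
    have h2 := Polynomial.prod_multiset_X_sub_C_of_monic_of_roots_card_eq
      (p := (X ^ Fintype.card (IsLocalRing.ResidueField O) - X :
        (IsLocalRing.ResidueField O)[X]))
      (monic_X_pow_sub (by rw [degree_X]; exact_mod_cast Fintype.one_lt_card))
      (by rw [h1, FiniteField.X_pow_card_sub_X_natDegree_eq _ Fintype.one_lt_card]; rfl)
    rw [h1] at h2
    exact h2
  -- `X ^ q - X` splits over the residue field, and the quotient by the prime ideal is a domain, so
  -- some factor vanishes.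
  have h0 : ∏ a : IsLocalRing.ResidueField O, (π x - j a) = 0 := by
    have h1 := congrArg (Polynomial.eval₂ j (π x)) hprod
    rw [eval₂_finsetProd] at h1
    simp only [eval₂_sub, eval₂_X, eval₂_C, eval₂_X_pow] at h1
    rw [h1, ← map_pow, ← map_sub]
    exact Ideal.Quotient.eq_zero_iff_mem.mpr hx
  obtain ⟨a, -, ha⟩ := Finset.prod_eq_zero_iff.mp h0
  obtain ⟨c, rfl⟩ := Ideal.Quotient.mk_surjective a
  exact ⟨c, hmem c, Ideal.Quotient.eq.mp (sub_eq_zero.mp ha)⟩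

/-- A geometric Frobenius fixes the `p`-th roots of unity if `q ≡ 1` modulo `p`. -/
theorem IsGeometricFrobenius.apply_eq_self_of_pow_eq_one {p m : ℕ} [hp : Fact p.Prime]
    (hpK : ‖(p : K)‖ = 1) {φ : LocalGalois K} (hφ : IsGeometricFrobenius K (p * m + 1) φ)
    (z : AlgebraicClosure K) (hz : z ^ p = 1) : φ z = z := by
  let _ : NormedField (AlgebraicClosure K) := spectralNorm.normedField K (AlgebraicClosure K)
  have hnorm : ∀ x : AlgebraicClosure K, ‖x‖ = spectralNorm K (AlgebraicClosure K) x :=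
    fun _ => rfl
  have : IsUltrametricDist (AlgebraicClosure K) :=
    IsUltrametricDist.isUltrametricDist_of_forall_norm_add_le_max_norm
      (isNonarchimedean_spectralNorm (K := K) (L := AlgebraicClosure K))
  have hpL : ‖(p : AlgebraicClosure K)‖ = 1 := by
    rw [hnorm, ← map_natCast (algebraMap K (AlgebraicClosure K)), spectralNorm_extends, hpK]
  have hz1 : ‖z‖ = 1 := by
    have h1 : ‖z‖ ^ p = 1 := by rw [← norm_pow, hz, norm_one]
    exact (pow_eq_one_iff_of_nonneg (norm_nonneg _) hp.out.ne_zero).mp h1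
  have hz0 : z ≠ 0 := norm_ne_zero_iff.mp (by rw [hz1]; exact one_ne_zero)
  have h1 : ‖φ⁻¹ z - z ^ (p * m + 1)‖ < 1 := hφ z hz1.le
  rw [pow_succ, pow_mul, hz, one_pow, one_mul] at h1
  -- `φ⁻¹ z` is congruent to `z ^ (p * m + 1) = z`, so the ratio is a `p`-th root of unity reducing
  -- to `1`.
  have h2 : φ⁻¹ z / z = 1 := eq_one_of_pow_eq_one_of_norm_sub_one_lt_one hpL
    (by rw [div_pow, ← map_pow, hz, map_one, div_one])
    (by rwa [div_sub_one hz0, norm_div, hz1, div_one])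
  have h3 : φ⁻¹ z = z := (div_eq_one_iff_eq hz0).mp h2
  conv_lhs => rw [← h3]
  rw [← AlgEquiv.mul_apply, mul_inv_cancel, AlgEquiv.one_apply]

end Density

/-! ### Matrices modulo ideals and lifting of idempotents -/

section MatrixIdeal

variable {A : Type*} [CommRing A] {n : Type*} [Fintype n] [DecidableEq n]

theorem Ideal.mul_mem_matrix_right {J : Ideal A} {M : Matrix n n A} (hM : M ∈ J.matrix n)
    (N : Matrix n n A) : M * N ∈ J.matrix n := by
  intro i j
  exact _root_.sum_mem fun k _ => J.mul_mem_right _ (hM i k)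

theorem Ideal.mul_mem_matrix_mul {I J : Ideal A} {M N : Matrix n n A} (hM : M ∈ I.matrix n)
    (hN : N ∈ J.matrix n) : M * N ∈ (I * J).matrix n := by
  intro i j
  exact _root_.sum_mem fun k _ => Ideal.mul_mem_mul (hM i k) (hN k j)

theorem Ideal.matrix_mono {I J : Ideal A} (h : I ≤ J) {M : Matrix n n A} (hM : M ∈ I.matrix n) :
    M ∈ J.matrix n := fun i j => h (hM i j)

variable (n) in
/-- Reduction of matrices modulo an ideal. -/
noncomputable def Ideal.matrixMk (J : Ideal A) : Matrix n n A →ₐ[A] Matrix n n (A ⧸ J) :=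
  (Ideal.Quotient.mkₐ A J).mapMatrix

theorem Ideal.matrixMk_eq_zero_iff {J : Ideal A} {M : Matrix n n A} :
    J.matrixMk n M = 0 ↔ M ∈ J.matrix n := by
  rw [← Matrix.ext_iff]
  exact forall_congr' fun i => forall_congr' fun j => Ideal.Quotient.eq_zero_iff_mem

theorem Ideal.matrixMk_eq_matrixMk_iff {J : Ideal A} {M N : Matrix n n A} :
    J.matrixMk n M = J.matrixMk n N ↔ M - N ∈ J.matrix n := by
  rw [← sub_eq_zero, ← map_sub, Ideal.matrixMk_eq_zero_iff]

theorem Matrix.eq_zero_of_forall_mem_pow_matrix (m : Ideal A) [IsHausdorff m A] {M : Matrix n n A}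
    (h : ∀ k : ℕ, M ∈ (m ^ k).matrix n) : M = 0 := by
  ext i j
  refine IsHausdorff.haus (I := m) inferInstance _ fun k => ?_
  rw [SModEq.zero]
  simpa using h k i j

theorem Polynomial.commute_aeval {R S : Type*} [CommSemiring R] [Semiring S] [Algebra R S]
    {x y : S} (h : Commute x y) (Q : R[X]) : Commute (aeval x Q) y := by
  induction Q using Polynomial.induction_on' with
  | add P Q hP hQ => rw [map_add]; exact hP.add_left hQ
  | monomial k a =>
    rw [aeval_monomial]
    have ha : Commute (algebraMap R S a) y := Algebra.commutes a y
    exact ha.mul_left (h.pow_left k)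

theorem Matrix.aeval_fromBlocks_zero {n₁ n₂ : Type*} [Fintype n₁] [DecidableEq n₁] [Fintype n₂]
    [DecidableEq n₂] (M₁ : Matrix n₁ n₁ A) (M₂ : Matrix n₂ n₂ A) (Q : A[X]) :
    aeval (Matrix.fromBlocks M₁ 0 0 M₂) Q =
      Matrix.fromBlocks (aeval M₁ Q) 0 0 (aeval M₂ Q) := by
  have hpow : ∀ k : ℕ, Matrix.fromBlocks M₁ 0 0 M₂ ^ k =
      Matrix.fromBlocks (M₁ ^ k) 0 0 (M₂ ^ k) := by
    intro k
    induction k with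
    | zero => simp [Matrix.fromBlocks_one]
    | succ k ih => simp [pow_succ, ih, Matrix.fromBlocks_multiply]
  induction Q using Polynomial.induction_on' with
  | add P Q hP hQ => rw [map_add, hP, hQ, Matrix.fromBlocks_add]; simp
  | monomial k a =>
    simp only [aeval_monomial, ← Algebra.smul_def, hpow, Matrix.fromBlocks_smul, smul_zero]

/-- Idempotent matrices lift along the reduction modulo an ideal for which the base ring is
complete, compatibly with commutation relations. -/
theorem Matrix.exists_isIdempotentElem_sub_mem (m : Ideal A) [IsAdicComplete m A]
    {E : Matrix n n A} (hE : E * E - E ∈ m.matrix n) :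
    ∃ e : Matrix n n A, e * e = e ∧ e - E ∈ m.matrix n ∧
      ∀ R : Matrix n n A, R * E = E * R → R * e = e * R := by
  -- Newton iteration `x ↦ 3x² - 2x³` for `x² = x`: it squares the defect `x² - x` up to the factor
  -- `4x² - 4x - 3`. All iterates are polynomials in `E`, so they inherit its commutation relations.
  let a : ℕ → Matrix n n A := fun k => (fun x => 3 * (x * x) - 2 * (x * x * x))^[k] E
  have ha : ∀ k, a (k + 1) = 3 * (a k * a k) - 2 * (a k * a k * a k) := fun k =>
    Function.iterate_succ_apply' _ _ _
  have hidem : ∀ k, a k * a k - a k ∈ (m ^ (k + 1)).matrix n := by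
    intro k
    induction k with
    | zero => rw [zero_add, pow_one]; exact hE
    | succ k ih =>
      have h1 : a (k + 1) * a (k + 1) - a (k + 1) =
          ((a k * a k - a k) * (a k * a k - a k)) * (4 * (a k * a k) - 4 * a k - 3) := by
        rw [ha]; noncomm_ring
      rw [h1]
      refine Ideal.mul_mem_matrix_right (Ideal.matrix_mono ?_ (Ideal.mul_mem_matrix_mul ih ih)) _
      rw [← pow_add]
      exact Ideal.pow_le_pow_right (by omega)
  have hstep : ∀ k, a (k + 1) - a k ∈ (m ^ (k + 1)).matrix n := by
    intro k
    have h1 : a (k + 1) - a k = (a k * a k - a k) * (1 - 2 * a k) := by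
      rw [ha]; noncomm_ring
    rw [h1]
    exact Ideal.mul_mem_matrix_right (hidem k) _
  have hcauchy : ∀ {k l : ℕ}, k ≤ l → a l - a k ∈ (m ^ (k + 1)).matrix n := by
    intro k l hkl
    induction l, hkl using Nat.le_induction with
    | base => rw [sub_self]; exact zero_mem _
    | succ l hl ih =>
      rw [← sub_add_sub_cancel]
      exact add_mem (Ideal.matrix_mono (Ideal.pow_le_pow_right (by omega)) (hstep l)) ih
  have hlim : ∀ i j, ∃ x : A, ∀ k, a k i j ≡ x [SMOD (m ^ k • ⊤ : Submodule A A)] := by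
    intro i j
    refine IsPrecomplete.prec (I := m) inferInstance fun {k l} hkl => ?_
    rw [SModEq.comm, SModEq.sub_mem]
    simpa using Ideal.pow_le_pow_right (Nat.le_succ k) (hcauchy hkl i j)
  choose e he using hlim
  have hae : ∀ k, a k - Matrix.of e ∈ (m ^ k).matrix n := by
    intro k i j
    have := SModEq.sub_mem.mp (he i j k)
    simpa using this
  have hea : ∀ k, (m ^ k).matrixMk n (a k) = (m ^ k).matrixMk n (Matrix.of e) := fun k =>
    Ideal.matrixMk_eq_matrixMk_iff.mpr (hae k)
  refine ⟨Matrix.of e, ?_, ?_, ?_⟩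
  · rw [← sub_eq_zero]
    refine Matrix.eq_zero_of_forall_mem_pow_matrix m fun k => ?_
    have h1 := Ideal.matrix_mono (Ideal.pow_le_pow_right (Nat.le_succ k)) (hidem k)
    rw [← Ideal.matrixMk_eq_zero_iff, map_sub, map_mul, hea] at h1
    rwa [← Ideal.matrixMk_eq_zero_iff, map_sub, map_mul]
  · have h1 : Matrix.of e - E = (a 1 - a 0) - (a 1 - Matrix.of e) := by
      change Matrix.of e - E = (a 1 - E) - (a 1 - Matrix.of e)
      abel
    rw [h1]
    exact sub_mem (by simpa using hstep 0) (by simpa using hae 1)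
  · intro R hR
    have hcomm : ∀ k, Commute R (a k) := by
      intro k
      induction k with
      | zero => exact hR
      | succ k ih =>
        rw [ha]
        exact ((Commute.ofNat_right R 3).mul_right (ih.mul_right ih)).sub_right
          ((Commute.ofNat_right R 2).mul_right ((ih.mul_right ih).mul_right ih))
    rw [← sub_eq_zero]
    refine Matrix.eq_zero_of_forall_mem_pow_matrix m fun k => ?_
    rw [← Ideal.matrixMk_eq_matrixMk_iff, map_mul, map_mul, ← hea, ← map_mul, ← map_mul,
      (hcomm k).eq]

end MatrixIdeal

/-! ### Block-diagonal representations -/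

section BlockDecomposition

variable {G : Type*} [Group G] {n₁ n₂ : Type*} [Fintype n₁] [DecidableEq n₁]
  [Fintype n₂] [DecidableEq n₂] {A : Type*} [CommRing A]

theorem Matrix.fromBlocks_one_zero_mul_comm_iff {M : Matrix (n₁ ⊕ n₂) (n₁ ⊕ n₂) A} :
    Matrix.fromBlocks 1 0 0 0 * M = M * Matrix.fromBlocks 1 0 0 0 ↔
      M.toBlocks₁₂ = 0 ∧ M.toBlocks₂₁ = 0 := by
  rw [← Matrix.fromBlocks_toBlocks M, Matrix.fromBlocks_multiply, Matrix.fromBlocks_multiply,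
    Matrix.fromBlocks_inj]
  simp [eq_comm]

theorem coe_directSumRep (r₁ : G →* GL n₁ A) (r₂ : G →* GL n₂ A) (σ : G) :
    (directSumRep r₁ r₂ σ : Matrix (n₁ ⊕ n₂) (n₁ ⊕ n₂) A) =
      Matrix.fromBlocks (r₁ σ : Matrix n₁ n₁ A) 0 0 (r₂ σ : Matrix n₂ n₂ A) := rfl

theorem map_comp_directSumRep {B : Type*} [CommRing B] (f : A →+* B) (r₁ : G →* GL n₁ A)
    (r₂ : G →* GL n₂ A) :
    (Matrix.GeneralLinearGroup.map (n := n₁ ⊕ n₂) f).comp (directSumRep r₁ r₂) =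
      directSumRep ((Matrix.GeneralLinearGroup.map (n := n₁) f).comp r₁)
        ((Matrix.GeneralLinearGroup.map (n := n₂) f).comp r₂) := by
  ext1 σ
  apply Units.ext
  change (Matrix.fromBlocks (r₁ σ : Matrix n₁ n₁ A) 0 0 (r₂ σ : Matrix n₂ n₂ A)).map f =
    Matrix.fromBlocks ((r₁ σ : Matrix n₁ n₁ A).map f) 0 0 ((r₂ σ : Matrix n₂ n₂ A).map f)
  rw [Matrix.fromBlocks_map]
  simp

theorem directSumRep_injective {r₁ s₁ : G →* GL n₁ A} {r₂ s₂ : G →* GL n₂ A}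
    (h : directSumRep r₁ r₂ = directSumRep s₁ s₂) : r₁ = s₁ ∧ r₂ = s₂ := by
  have h1 : ∀ σ, (r₁ σ : Matrix n₁ n₁ A) = s₁ σ ∧ (r₂ σ : Matrix n₂ n₂ A) = s₂ σ := by
    intro σ
    have h2 := congrArg Units.val (DFunLike.congr_fun h σ)
    rw [coe_directSumRep, coe_directSumRep, Matrix.fromBlocks_inj] at h2
    exact ⟨h2.1, h2.2.2.2⟩
  exact ⟨MonoidHom.ext fun σ => Units.ext (h1 σ).1, MonoidHom.ext fun σ => Units.ext (h1 σ).2⟩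

/-- A representation commuting with the block idempotent is a direct sum. -/
theorem exists_eq_directSumRep [TopologicalSpace G] [IsTopologicalGroup G] [TopologicalSpace A]
    (s : G →* GL (n₁ ⊕ n₂) A)
    (hs : ∀ σ, Matrix.fromBlocks 1 0 0 0 * (s σ : Matrix (n₁ ⊕ n₂) (n₁ ⊕ n₂) A) =
      (s σ : Matrix (n₁ ⊕ n₂) (n₁ ⊕ n₂) A) * Matrix.fromBlocks 1 0 0 0)
    (hcont : Continuous s) :
    ∃ (r₁ : G →* GL n₁ A) (r₂ : G →* GL n₂ A),
      Continuous r₁ ∧ Continuous r₂ ∧ s = directSumRep r₁ r₂ := by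
  have hblock : ∀ σ, (s σ : Matrix (n₁ ⊕ n₂) (n₁ ⊕ n₂) A) =
      Matrix.fromBlocks (s σ).1.toBlocks₁₁ 0 0 (s σ).1.toBlocks₂₂ := by
    intro σ
    obtain ⟨h1, h2⟩ := Matrix.fromBlocks_one_zero_mul_comm_iff.mp (hs σ)
    conv_lhs => rw [← Matrix.fromBlocks_toBlocks (s σ).1, h1, h2]
  have hone : Matrix.fromBlocks (s 1).1.toBlocks₁₁ 0 0 (s 1).1.toBlocks₂₂ =
      Matrix.fromBlocks (1 : Matrix n₁ n₁ A) 0 0 (1 : Matrix n₂ n₂ A) := by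
    rw [← hblock, map_one, Matrix.fromBlocks_one]; rfl
  have hmul : ∀ σ τ, Matrix.fromBlocks (s (σ * τ)).1.toBlocks₁₁ 0 0 (s (σ * τ)).1.toBlocks₂₂ =
      Matrix.fromBlocks ((s σ).1.toBlocks₁₁ * (s τ).1.toBlocks₁₁) 0 0
        ((s σ).1.toBlocks₂₂ * (s τ).1.toBlocks₂₂) := by
    intro σ τ
    rw [← hblock, map_mul, Units.val_mul, hblock σ, hblock τ, Matrix.fromBlocks_multiply]
    simp
  rw [Matrix.fromBlocks_inj] at hone
  simp only [Matrix.fromBlocks_inj] at hmul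
  let f₁ : G →* Matrix n₁ n₁ A :=
    { toFun σ := (s σ).1.toBlocks₁₁, map_one' := hone.1, map_mul' σ τ := (hmul σ τ).1 }
  let f₂ : G →* Matrix n₂ n₂ A :=
    { toFun σ := (s σ).1.toBlocks₂₂, map_one' := hone.2.2.2, map_mul' σ τ := (hmul σ τ).2.2.2 }
  have hval : Continuous fun σ => (s σ : Matrix (n₁ ⊕ n₂) (n₁ ⊕ n₂) A) :=
    Units.continuous_val.comp hcont
  have hf₁ : Continuous f₁ := hval.matrix_submatrix Sum.inl Sum.inl
  have hf₂ : Continuous f₂ := hval.matrix_submatrix Sum.inr Sum.inr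
  -- The topology on units also requires continuity of the inverse, here `σ ↦ fᵢ σ⁻¹`.
  refine ⟨f₁.toHomUnits, f₂.toHomUnits, Units.continuous_iff.mpr ⟨hf₁, hf₁.comp continuous_inv⟩,
    Units.continuous_iff.mpr ⟨hf₂, hf₂.comp continuous_inv⟩, ?_⟩
  ext1 σ
  exact Units.ext (hblock σ)

end BlockDecomposition

/-! ### Vanishing of the off-diagonal blocks -/

section OffDiagonal

variable {K : Type*} [NontriviallyNormedField K] [IsUltrametricDist K] [CompleteSpace K]
  {A : Type*} [CommRing A] [TopologicalSpace A] {n : Type*} [Fintype n] [DecidableEq n]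

theorem isOpen_matrix_of_isAdic [IsTopologicalRing A] {m : Ideal A} (hm : IsAdic m) (k : ℕ) :
    IsOpen ((m ^ k).matrix n : Set (Matrix n n A)) := by
  have h1 : IsOpen ((m ^ k : Ideal A) : Set A) := (isAdic_iff.mp hm).1 k
  have h2 : ((m ^ k).matrix n : Set (Matrix n n A)) =
      ⋂ i, ⋂ j, (fun M : Matrix n n A => M i j) ⁻¹' ((m ^ k : Ideal A) : Set A) := by
    ext M
    simp [Ideal.mem_matrix]
  rw [h2]
  exact isOpen_iInter_of_finite fun i => isOpen_iInter_of_finite fun j =>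
    h1.preimage (continuous_id.matrix_elem i j)

/-- One step of the `m`-adic approximation: the off-diagonal part of inertia, an additive
character modulo `m ^ (k + 1)` that is invariant under Frobenius, vanishes modulo `m ^ (k + 1)`. -/
theorem offDiagonal_mem_pow_succ [IsTopologicalRing A] [CharZero K] {p : ℕ} [Fact p.Prime]
    (hpK : ‖(p : K)‖ = 1)
    {φ : LocalGalois K} (hφ : ∀ z : AlgebraicClosure K, z ^ p = 1 → φ z = z)
    {m : Ideal A} (hm : IsAdic m) (hpm : (p : A) ∈ m)
    (s : LocalGalois K →* GL n A) (hs : Continuous s)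
    (hsI : ∀ σ ∈ inertiaGroup K, (s σ : Matrix n n A) - 1 ∈ m.matrix n)
    {e : Matrix n n A} (he : e * e = e) (heφ : e * (s φ : Matrix n n A) = s φ * e)
    {Q : A[X]} (hQ : aeval (s φ : Matrix n n A) Q - e ∈ m.matrix n) {k : ℕ}
    (hk : ∀ σ ∈ inertiaGroup K, e * (s σ : Matrix n n A) * (1 - e) ∈ (m ^ k).matrix n) :
    ∀ σ ∈ inertiaGroup K, e * (s σ : Matrix n n A) * (1 - e) ∈ (m ^ (k + 1)).matrix n := by
  let b : LocalGalois K → Matrix n n A := fun σ => e * (s σ : Matrix n n A) * (1 - e)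
  let π := (m ^ (k + 1)).matrixMk n
  have hb : ∀ σ ∈ inertiaGroup K, b σ ∈ (m ^ k).matrix n := hk
  have hleft : ∀ M ∈ m.matrix n, ∀ σ ∈ inertiaGroup K, π (M * b σ) = 0 := by
    intro M hM σ hσ
    rw [Ideal.matrixMk_eq_zero_iff, pow_succ']
    exact Ideal.mul_mem_matrix_mul hM (hb σ hσ)
  have hright : ∀ M ∈ m.matrix n, ∀ σ ∈ inertiaGroup K, π (b σ * M) = 0 := by
    intro M hM σ hσ
    rw [Ideal.matrixMk_eq_zero_iff, pow_succ]
    exact Ideal.mul_mem_matrix_mul (hb σ hσ) hM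
  have heb : ∀ σ, e * b σ = b σ := fun σ => by
    simp only [b, ← mul_assoc, he]
  have hbe : ∀ σ, b σ * e = 0 := fun σ => by
    simp only [b, mul_assoc, sub_mul, one_mul, he, sub_self, mul_zero]
  have hadd : ∀ σ ∈ inertiaGroup K, ∀ τ ∈ inertiaGroup K, π (b (σ * τ)) = π (b σ) + π (b τ) := by
    intro σ hσ τ hτ
    -- The last two terms are products of matrices over `m` and over `m ^ k`, so they vanish modulo
    -- `m ^ (k + 1)`.
    have h1 : b (σ * τ) = b σ + b τ + (e * (s σ - 1)) * b τ + b σ * ((s τ - 1) * (1 - e)) := by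
      simp only [b, map_mul, Units.val_mul]
      have h2 : e * (1 - e) = 0 := by rw [mul_sub, mul_one, he, sub_self]
      have h3 : (1 - e) * (1 - e) = 1 - e := by rw [sub_mul, one_mul, h2, sub_zero]
      have h4 : e * ((s σ : Matrix n n A) - 1) * (e * s τ * (1 - e)) =
          e * s σ * e * s τ * (1 - e) - e * s τ * (1 - e) := by
        rw [mul_sub, mul_one, sub_mul]
        simp only [← mul_assoc, he]
      have h5 : e * (s σ : Matrix n n A) * (1 - e) * (((s τ : Matrix n n A) - 1) * (1 - e)) =
          e * s σ * (1 - e) * s τ * (1 - e) - e * s σ * (1 - e) := by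
        rw [sub_mul, one_mul, mul_sub, mul_assoc _ (1 - e) (1 - e), h3]
        simp only [← mul_assoc]
      rw [h4, h5]
      noncomm_ring
    have h2 : e * ((s σ : Matrix n n A) - 1) ∈ m.matrix n :=
      (m.matrix n).mul_mem_left e (hsI σ hσ)
    rw [h1, map_add, map_add, map_add, hleft _ h2 τ hτ,
      hright _ (Ideal.mul_mem_matrix_right (hsI τ hτ) _) σ hσ, add_zero, add_zero]
  have htors : ∀ σ ∈ inertiaGroup K, p • π (b σ) = 0 := by
    intro σ hσ
    rw [← map_nsmul, ← hleft ((p : Matrix n n A)) ?_ σ hσ, nsmul_eq_mul]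
    intro i j
    rw [← Matrix.diagonal_natCast, Matrix.diagonal_apply]
    split_ifs
    · exact hpm
    · exact zero_mem _
  let V : AddSubgroup (Matrix n n (A ⧸ m ^ (k + 1))) := (nsmulAddMonoidHom p).ker
  have hV : ∀ σ ∈ inertiaGroup K, π (b σ) ∈ V := htors
  let f : inertiaGroup K →* Multiplicative V := MonoidHom.mk'
    (fun σ => Multiplicative.ofAdd ⟨π (b σ), hV σ σ.2⟩)
    (fun σ τ => congrArg Multiplicative.ofAdd (Subtype.ext (hadd σ σ.2 τ τ.2)))
  have hopen : IsOpen (f.ker : Set (inertiaGroup K)) := by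
    have h1 : (f.ker : Set (inertiaGroup K)) =
        (fun σ : inertiaGroup K => b σ) ⁻¹' ((m ^ (k + 1)).matrix n : Set (Matrix n n A)) := by
      ext σ
      rw [Set.mem_preimage, SetLike.mem_coe, SetLike.mem_coe, ← Ideal.matrixMk_eq_zero_iff]
      exact ⟨fun h => congrArg (fun v : Multiplicative V => (v.toAdd).1) h,
        fun h => congrArg Multiplicative.ofAdd (Subtype.ext h)⟩
    rw [h1]
    refine (isOpen_matrix_of_isAdic hm (k + 1)).preimage ?_
    have h2 : Continuous fun σ : LocalGalois K => (s σ : Matrix n n A) :=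
      Units.continuous_val.comp hs
    exact (((continuous_const.mul h2).mul continuous_const).comp continuous_subtype_val)
  intro σ hσ
  have hconj : π (b (φ * σ * φ⁻¹)) = π (b σ) := by
    have h1 := monoidHom_inertiaGroup_conj hpK φ hφ (V := V) (fun v => Subtype.ext v.2) f hopen ⟨σ, hσ⟩
    exact congrArg (fun v : Multiplicative V => (v.toAdd).1) h1
  have heφ' : (s φ : Matrix n n A) * (1 - e) = (1 - e) * s φ := by
    rw [mul_sub, sub_mul, heφ, mul_one, one_mul]
  have hφb : b (φ * σ * φ⁻¹) * s φ = s φ * b σ := by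
    simp only [b, map_mul, Units.val_mul]
    have h1 : ((s φ⁻¹ : GL n A) : Matrix n n A) * s φ = 1 := by
      rw [← Units.val_mul, ← map_mul, inv_mul_cancel, map_one, Units.val_one]
    calc e * (s φ * s σ * ((s φ⁻¹ : GL n A) : Matrix n n A)) * (1 - e) * s φ
        = (e * s φ) * s σ * (((s φ⁻¹ : GL n A) : Matrix n n A) * s φ) * (1 - e) := by
          rw [mul_assoc _ (1 - e), ← heφ']; simp only [mul_assoc]
      _ = s φ * (e * s σ * (1 - e)) := by rw [h1, mul_one, heφ]; simp only [mul_assoc]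
  have hcomm : Commute (π (s φ)) (π (b σ)) := by
    have h1 := congrArg π hφb
    rw [map_mul π (b _), map_mul π _ (b σ), hconj] at h1
    exact h1.symm
  -- Modulo `m ^ (k + 1)` the polynomial `Q` in Frobenius acts on `b σ` as `e` does: as the identity
  -- from the left and as zero from the right.
  have h1 := (Polynomial.commute_aeval hcomm Q).eq
  rw [aeval_algHom_apply, ← map_mul, ← map_mul] at h1
  have h2 : aeval (s φ : Matrix n n A) Q = (aeval (s φ : Matrix n n A) Q - e) + e := by abel
  rw [h2, add_mul, mul_add, map_add, map_add, hleft _ hQ σ hσ, hright _ hQ σ hσ, heb, hbe, map_zero,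
    zero_add, add_zero] at h1
  exact Ideal.matrixMk_eq_zero_iff.mp h1

/-- Induction on the power of `m`, starting from the empty condition at `m ^ 0`; the powers
intersect in zero because `A` is Hausdorff. -/
theorem offDiagonal_eq_zero [IsTopologicalRing A] [CharZero K] {p : ℕ} [Fact p.Prime]
    (hpK : ‖(p : K)‖ = 1)
    {φ : LocalGalois K} (hφ : ∀ z : AlgebraicClosure K, z ^ p = 1 → φ z = z)
    {m : Ideal A} [IsHausdorff m A] (hm : IsAdic m) (hpm : (p : A) ∈ m)
    (s : LocalGalois K →* GL n A) (hs : Continuous s)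
    (hsI : ∀ σ ∈ inertiaGroup K, (s σ : Matrix n n A) - 1 ∈ m.matrix n)
    {e : Matrix n n A} (he : e * e = e) (heφ : e * (s φ : Matrix n n A) = s φ * e)
    {Q : A[X]} (hQ : aeval (s φ : Matrix n n A) Q - e ∈ m.matrix n) :
    ∀ σ ∈ inertiaGroup K, e * (s σ : Matrix n n A) * (1 - e) = 0 := by
  have h : ∀ k, ∀ σ ∈ inertiaGroup K,
      e * (s σ : Matrix n n A) * (1 - e) ∈ (m ^ k).matrix n := by
    intro k
    induction k with
    | zero => intro σ _; rw [pow_zero, Ideal.one_eq_top]; exact fun _ _ => trivial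
    | succ k ih => exact offDiagonal_mem_pow_succ hpK hφ hm hpm s hs hsI he heφ hQ ih
  exact fun σ hσ => Matrix.eq_zero_of_forall_mem_pow_matrix m fun k => h k σ hσ

/-- If a polynomial in Frobenius reduces to the idempotent `e`, which commutes with Frobenius,
then the whole representation commutes with `e`. -/
theorem mul_comm_of_frobenius_mul_comm [IsTopologicalRing A] [T1Space A] [CharZero K] {p q : ℕ}
    [Fact p.Prime] (hpK : ‖(p : K)‖ = 1) {φ : LocalGalois K}
    (hK : ∀ x : algClosureIntegers K, x ^ q - x ∈ algClosureMaximalIdeal K →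
      ∃ (c : K) (hc : algebraMap K (AlgebraicClosure K) c ∈ algClosureIntegers K),
        x - ⟨_, hc⟩ ∈ algClosureMaximalIdeal K)
    (hφ : ∀ z : AlgebraicClosure K, z ^ p = 1 → φ z = z) (hφq : IsGeometricFrobenius K q φ)
    {m : Ideal A} [IsHausdorff m A] (hm : IsAdic m) (hpm : (p : A) ∈ m)
    (s : LocalGalois K →* GL n A) (hs : Continuous s)
    (hsI : ∀ σ ∈ inertiaGroup K, (s σ : Matrix n n A) - 1 ∈ m.matrix n)
    {e : Matrix n n A} (he : e * e = e) (heφ : e * (s φ : Matrix n n A) = s φ * e)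
    {Q : A[X]} (hQ : aeval (s φ : Matrix n n A) Q - e ∈ m.matrix n) (σ : LocalGalois K) :
    e * (s σ : Matrix n n A) = s σ * e := by
  have h1 := offDiagonal_eq_zero hpK hφ hm hpm s hs hsI he heφ hQ
  -- The complementary idempotent is approximated by `1 - Q`; this kills the other off-diagonal
  -- block.
  have h2 := offDiagonal_eq_zero hpK hφ hm hpm s hs hsI (e := 1 - e) (Q := 1 - Q)
    (by rw [sub_mul, one_mul, mul_sub, mul_one, he, sub_self, sub_zero])
    (by rw [sub_mul, mul_sub, one_mul, mul_one, heφ])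
    (by rw [map_sub, map_one, sub_sub_sub_cancel_left, ← neg_sub]; exact neg_mem hQ)
  let H : Subgroup (LocalGalois K) :=
    { carrier := {σ | e * (s σ : Matrix n n A) = s σ * e}
      one_mem' := by simp
      mul_mem' := fun {σ τ} hσ hτ => by
        have hσ' : Commute e (s σ : Matrix n n A) := hσ
        have hτ' : Commute e (s τ : Matrix n n A) := hτ
        have := (hσ'.mul_right hτ').eq
        rwa [← Units.val_mul, ← map_mul] at this
      inv_mem' := fun {σ} hσ => by
        have hσ' : Commute e (s σ : Matrix n n A) := hσ
        have := hσ'.units_inv_right.eq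
        rwa [← map_inv] at this }
  have hval : Continuous fun σ : LocalGalois K => (s σ : Matrix n n A) :=
    Units.continuous_val.comp hs
  have htop := eq_top_of_inertiaGroup_le_of_frobenius_mem hK hφq H (by
    have h3 : (H : Set (LocalGalois K)) =
        (fun σ => e * (s σ : Matrix n n A) - s σ * e) ⁻¹' {0} := by
      ext σ
      exact sub_eq_zero.symm
    rw [h3]
    exact isClosed_singleton.preimage
      ((continuous_const.mul hval).sub (hval.mul continuous_const)))
    (fun τ hτ => by
      have h3 := h1 τ hτ
      have h4 := h2 τ hτ
      rw [sub_sub_cancel, sub_mul, one_mul, sub_mul] at h4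
      rw [mul_sub, mul_one] at h3
      exact (sub_eq_zero.mp h3).trans (sub_eq_zero.mp h4).symm) heφ
  have : σ ∈ H := htop ▸ Subgroup.mem_top σ
  exact this

end OffDiagonal

/-! ### Splitting off the Frobenius blocks -/

section BlockFrobenius

variable {A : Type*} [CommRing A] [IsLocalRing A] {n n₁ n₂ : Type*} [Fintype n] [DecidableEq n]
  [Fintype n₁] [DecidableEq n₁] [Fintype n₂] [DecidableEq n₂]

theorem IsLocalRing.map_residue_eq_map_residue_iff {M N : Matrix n n A} :
    M.map (residue A) = N.map (residue A) ↔ M - N ∈ (maximalIdeal A).matrix n :=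
  Ideal.matrixMk_eq_matrixMk_iff

theorem IsLocalRing.isUnit_of_sub_one_mem_matrix {X : Matrix n n A}
    (hX : X - 1 ∈ (maximalIdeal A).matrix n) : IsUnit X := by
  rw [Matrix.isUnit_iff_isUnit_det, ← residue_ne_zero_iff_isUnit, RingHom.map_det,
    RingHom.mapMatrix_apply, map_residue_eq_map_residue_iff.mpr hX]
  simp

theorem Matrix.map_aeval {R S : Type*} [CommRing R] [CommRing S] (f : R →+* S)
    (M : Matrix n n R) (Q : R[X]) : (aeval M Q).map f = aeval (M.map f) (Q.map f) :=
  Polynomial.map_aeval_eq_aeval_map (φ := f) (ψ := f.mapMatrix) (by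
    ext a : 1
    simp [Matrix.algebraMap_eq_diagonal]) Q M

/-- If the characteristic polynomials of two blocks of the reduction of `R` are coprime, then a
polynomial in `R` reduces to the idempotent of the first block. -/
theorem IsLocalRing.exists_aeval_sub_fromBlocks_mem {k : Type*} [Field k]
    (f : k →+* ResidueField A) {M₁ : Matrix n₁ n₁ k} {M₂ : Matrix n₂ n₂ k}
    (hcop : IsCoprime M₁.charpoly M₂.charpoly) {R : Matrix (n₁ ⊕ n₂) (n₁ ⊕ n₂) A}
    (hR : R.map (residue A) = (Matrix.fromBlocks M₁ 0 0 M₂).map f) :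
    ∃ Q : A[X], aeval R Q - Matrix.fromBlocks 1 0 0 0 ∈ (maximalIdeal A).matrix (n₁ ⊕ n₂) := by
  obtain ⟨u, v, huv⟩ := hcop
  -- By Bézout and Cayley–Hamilton, `v * M₂.charpoly` takes the value `1` at `M₁` and `0` at `M₂`.
  obtain ⟨Q, hQ⟩ := Polynomial.map_surjective (residue A) residue_surjective
    ((v * M₂.charpoly).map f)
  refine ⟨Q, map_residue_eq_map_residue_iff.mp ?_⟩
  have h1 : aeval M₁ (v * M₂.charpoly) = 1 := by
    have := congrArg (aeval M₁) huv
    rwa [map_add, map_mul, Matrix.aeval_self_charpoly, mul_zero, zero_add, map_one] at this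
  have h2 : aeval M₂ (v * M₂.charpoly) = 0 := by
    rw [map_mul, Matrix.aeval_self_charpoly, mul_zero]
  rw [Matrix.map_aeval, hQ, hR, ← Matrix.map_aeval, Matrix.aeval_fromBlocks_zero, h1, h2, Matrix.fromBlocks_map,
    Matrix.fromBlocks_map]
  simp

/-- Over a complete local ring, a matrix with a polynomial expression reducing to an idempotent
`e₀` is conjugate, by a matrix reducing to the identity, to a matrix commuting with `e₀`. -/
theorem IsLocalRing.exists_conj_mul_comm [IsAdicComplete (maximalIdeal A) A]
    {e₀ : Matrix n n A} (he₀ : e₀ * e₀ = e₀) {R : Matrix n n A} {Q : A[X]}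
    (hQ : aeval R Q - e₀ ∈ (maximalIdeal A).matrix n) :
    ∃ X : GL n A, (X : Matrix n n A) - 1 ∈ (maximalIdeal A).matrix n ∧
      e₀ * ((X : Matrix n n A) * R * ((X⁻¹ : GL n A) : Matrix n n A)) =
        (X : Matrix n n A) * R * ((X⁻¹ : GL n A) : Matrix n n A) * e₀ := by
  have hE : aeval R Q * aeval R Q - aeval R Q ∈ (maximalIdeal A).matrix n := by
    rw [← Ideal.matrixMk_eq_matrixMk_iff] at hQ ⊢
    rw [map_mul, hQ, ← map_mul, he₀]
  obtain ⟨e, he, heE, hcomm⟩ := Matrix.exists_isIdempotentElem_sub_mem (maximalIdeal A) hE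
  have hRe : R * e = e * R := hcomm R (Polynomial.commute_aeval (Commute.refl R) Q).eq.symm
  have hee₀ : e - e₀ ∈ (maximalIdeal A).matrix n := by
    have := add_mem heE hQ
    rwa [sub_add_sub_cancel] at this
  -- This standard intertwiner `X` of two nearby idempotents satisfies `X * e = e₀ * X`.
  have hX1 : e₀ * e + (1 - e₀) * (1 - e) - 1 ∈ (maximalIdeal A).matrix n := by
    have h1 : e₀ * e + (1 - e₀) * (1 - e) - 1 = (2 * e₀ - 1) * (e - e₀) + 2 * (e₀ * e₀ - e₀) := by
      noncomm_ring
    rw [h1, he₀, sub_self, mul_zero, add_zero]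
    exact ((maximalIdeal A).matrix n).mul_mem_left _ hee₀
  obtain ⟨X, hX⟩ := isUnit_of_sub_one_mem_matrix hX1
  refine ⟨X, hX ▸ hX1, ?_⟩
  have hXe : (X : Matrix n n A) * e = e₀ * X := by
    have h1 : (1 - e) * e = 0 := by rw [sub_mul, one_mul, he, sub_self]
    have h2 : e₀ * (1 - e₀) = 0 := by rw [mul_sub, mul_one, he₀, sub_self]
    rw [hX, add_mul, mul_add, mul_assoc, he, mul_assoc, h1, ← mul_assoc, he₀, ← mul_assoc, h2,
      mul_zero, zero_mul]
  have hXinv : ((X⁻¹ : GL n A) : Matrix n n A) * e₀ = e * ((X⁻¹ : GL n A) : Matrix n n A) := by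
    rw [← Units.inv_mul_cancel_left X (e * _), ← mul_assoc (X : Matrix n n A), hXe, mul_assoc e₀,
      Units.mul_inv, mul_one]
  rw [mul_assoc _ _ e₀, hXinv, ← mul_assoc, ← mul_assoc, ← hXe, mul_assoc _ e R, ← hRe]
  simp only [mul_assoc]

end BlockFrobenius

/-! ### Decomposition of lifts -/

section Lifts

variable {K : Type*} [NontriviallyNormedField K] [IsUltrametricDist K] [CompleteSpace K]

/-- A lift of an unramified direct sum of representations whose Frobenius characteristic
polynomials are coprime is a direct sum of lifts, if `q ≡ 1` modulo `p`. -/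
theorem exists_conj_eq_directSumRep_of_isCoprime_charpoly [CharZero K] (O : ValuationSubring K)
    (hO : ∀ x : K, x ∈ O ↔ ‖x‖ ≤ 1) {p : ℕ} [Fact p.Prime] {k : Type*} [Field k] [CharP k p]
    (hq : (Nat.card (IsLocalRing.ResidueField O) : k) = 1)
    {A : Type*} [CommRing A] [IsLocalRing A] [IsAdicComplete (IsLocalRing.maximalIdeal A) A]
    [Algebra k (IsLocalRing.ResidueField A)]
    [TopologicalSpace A] (htop : IsAdic (IsLocalRing.maximalIdeal A))
    {n₁ n₂ : Type*} [Fintype n₁] [DecidableEq n₁] [Fintype n₂] [DecidableEq n₂]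
    {rbar₁ : LocalGalois K →* GL n₁ k} {rbar₂ : LocalGalois K →* GL n₂ k}
    (hunr : IsUnramifiedRep (directSumRep rbar₁ rbar₂)) {φ : LocalGalois K}
    (hφ : IsGeometricFrobenius K (Nat.card (IsLocalRing.ResidueField O)) φ)
    (hcop : IsCoprime (rbar₁ φ : Matrix n₁ n₁ k).charpoly (rbar₂ φ : Matrix n₂ n₂ k).charpoly)
    {r : LocalGalois K →* GL (n₁ ⊕ n₂) A} (hr : IsLift (directSumRep rbar₁ rbar₂) r) :
    ∃ X : GL (n₁ ⊕ n₂) A,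
      (X : Matrix (n₁ ⊕ n₂) (n₁ ⊕ n₂) A) - 1 ∈ (IsLocalRing.maximalIdeal A).matrix (n₁ ⊕ n₂) ∧
      ∃ (r₁ : LocalGalois K →* GL n₁ A) (r₂ : LocalGalois K →* GL n₂ A),
        IsLift rbar₁ r₁ ∧ IsLift rbar₂ r₂ ∧ ∀ σ, X * r σ * X⁻¹ = directSumRep r₁ r₂ σ := by
  have : IsTopologicalRing A := by
    have h : ‹TopologicalSpace A› = _ := htop
    subst h
    exact @NonarchimedeanRing.toIsTopologicalRing A _ _ (Ideal.nonarchimedean _)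
  have : T2Space A := htop.isHausdorff_iff.mp inferInstance
  obtain ⟨hrcont, hres⟩ := hr
  have hres' : ∀ σ, (r σ : Matrix (n₁ ⊕ n₂) (n₁ ⊕ n₂) A).map (IsLocalRing.residue A) =
      (directSumRep rbar₁ rbar₂ σ : Matrix (n₁ ⊕ n₂) (n₁ ⊕ n₂) k).map
        (algebraMap k (IsLocalRing.ResidueField A)) := fun σ =>
    congrArg Units.val (DFunLike.congr_fun hres σ)
  have hfin : Finite (IsLocalRing.ResidueField O) := by
    -- An infinite residue field would have `Nat.card` zero, giving `0 = 1` in `k`.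
    refine Nat.finite_of_card_ne_zero fun h0 => ?_
    rw [h0, Nat.cast_zero] at hq
    exact zero_ne_one hq
  have hpos : 0 < Nat.card (IsLocalRing.ResidueField O) := Nat.card_pos
  obtain ⟨c, hc⟩ : p ∣ Nat.card (IsLocalRing.ResidueField O) - 1 := by
    rw [← CharP.cast_eq_zero_iff k p, Nat.cast_sub hpos, hq, Nat.cast_one, sub_self]
  have hqc : Nat.card (IsLocalRing.ResidueField O) = p * c + 1 := by omega
  have hpK : ‖(p : K)‖ = 1 := norm_eq_one_of_norm_add_one_lt_one (m := c)
    (hqc ▸ norm_card_residueField_lt_one O hO)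
  have hroots := IsGeometricFrobenius.apply_eq_self_of_pow_eq_one hpK (hqc ▸ hφ)
  have hpm : (p : A) ∈ IsLocalRing.maximalIdeal A := by
    rw [← IsLocalRing.residue_eq_zero_iff, map_natCast,
      ← map_natCast (algebraMap k (IsLocalRing.ResidueField A)), CharP.cast_eq_zero, map_zero]
  obtain ⟨Q, hQ⟩ := IsLocalRing.exists_aeval_sub_fromBlocks_mem
    (algebraMap k (IsLocalRing.ResidueField A)) hcop (hres' φ)
  have he₀ : Matrix.fromBlocks (1 : Matrix n₁ n₁ A) 0 0 (0 : Matrix n₂ n₂ A) *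
      Matrix.fromBlocks 1 0 0 0 = Matrix.fromBlocks 1 0 0 0 := by
    simp [Matrix.fromBlocks_multiply]
  obtain ⟨X, hX, hXφ⟩ := IsLocalRing.exists_conj_mul_comm he₀ hQ
  let s : LocalGalois K →* GL (n₁ ⊕ n₂) A := (MulAut.conj X).toMonoidHom.comp r
  have hs : ∀ σ, s σ = X * r σ * X⁻¹ := fun σ => rfl
  have hscont : Continuous s := (continuous_const.mul hrcont).mul continuous_const
  have hX1 : Matrix.GeneralLinearGroup.map (n := n₁ ⊕ n₂) (IsLocalRing.residue A) X = 1 := by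
    apply Units.ext
    have := IsLocalRing.map_residue_eq_map_residue_iff.mpr hX
    exact this.trans (by simp)
  have hsr : (Matrix.GeneralLinearGroup.map (n := n₁ ⊕ n₂) (IsLocalRing.residue A)).comp s =
      (Matrix.GeneralLinearGroup.map (n := n₁ ⊕ n₂) (IsLocalRing.residue A)).comp r := by
    ext1 σ
    change Matrix.GeneralLinearGroup.map _ (X * r σ * X⁻¹) =
      Matrix.GeneralLinearGroup.map _ (r σ)
    rw [map_mul, map_mul, map_inv, hX1, one_mul,
      inv_one, mul_one]
  have hsr' : ∀ σ, (s σ : Matrix (n₁ ⊕ n₂) (n₁ ⊕ n₂) A).map (IsLocalRing.residue A) =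
      (r σ : Matrix (n₁ ⊕ n₂) (n₁ ⊕ n₂) A).map (IsLocalRing.residue A) := fun σ =>
    congrArg Units.val (DFunLike.congr_fun hsr σ)
  have hQs : aeval (s φ : Matrix (n₁ ⊕ n₂) (n₁ ⊕ n₂) A) Q - Matrix.fromBlocks 1 0 0 0 ∈
      (IsLocalRing.maximalIdeal A).matrix (n₁ ⊕ n₂) := by
    rw [← Ideal.matrixMk_eq_matrixMk_iff] at hQ ⊢
    rw [← hQ, ← aeval_algHom_apply, ← aeval_algHom_apply]
    congr 2
    exact hsr' φ
  have hsI : ∀ σ ∈ inertiaGroup K, (s σ : Matrix (n₁ ⊕ n₂) (n₁ ⊕ n₂) A) - 1 ∈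
      (IsLocalRing.maximalIdeal A).matrix (n₁ ⊕ n₂) := by
    intro σ hσ
    rw [← IsLocalRing.map_residue_eq_map_residue_iff, hsr', hres', hunr σ hσ]
    simp
  have hcomm := mul_comm_of_frobenius_mul_comm hpK
    (exists_sub_mem_algClosureMaximalIdeal_of_pow_card O hO) hroots hφ htop hpm s hscont hsI he₀
    hXφ hQs
  obtain ⟨r₁, r₂, hr₁, hr₂, hsum⟩ := exists_eq_directSumRep s hcomm hscont
  -- As `X` reduces to `1`, the reductions of `s` and `r` agree; comparing blocks shows that `r₁`
  -- and `r₂` lift the given summands.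
  rw [hsum, map_comp_directSumRep, hres, map_comp_directSumRep] at hsr
  obtain ⟨h1, h2⟩ := directSumRep_injective hsr
  exact ⟨X, hX, r₁, r₂, ⟨hr₁, h1⟩, ⟨hr₂, h2⟩, fun σ => by rw [← hs, hsum]⟩

end Lifts

/-! ### The arithmetic setting -/

instance charP_padicResidueField (p : ℕ) [hp : Fact p.Prime]
    (E : IntermediateField ℚ_[p] (PadicAlgCl p)) : CharP (padicResidueField p E) p := by
  refine (CharP.charP_iff_prime_eq_zero hp.out).mpr ?_
  rw [← map_natCast (IsLocalRing.residue (padicValuationRing p E)),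
    IsLocalRing.residue_eq_zero_iff, IsLocalRing.mem_maximalIdeal, mem_nonunits_iff]
  intro hu
  obtain ⟨x, hx⟩ := hu.exists_right_inv
  have h1 : (PadicAlgCl.valued p).v (algebraMap E (PadicAlgCl p) x) ≤ 1 := x.2
  have h2 : (p : PadicAlgCl p) * algebraMap E (PadicAlgCl p) x = 1 := by
    have := congrArg (fun y : padicValuationRing p E => algebraMap E (PadicAlgCl p) y) hx
    simpa using this
  have h3 := congrArg (PadicAlgCl.valued p).v h2
  rw [map_mul, PadicAlgCl.valuation_p, map_one] at h3
  have h4 : 1 / (p : NNReal) < 1 := by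
    rw [one_div]
    exact inv_lt_one_of_one_lt₀ (by exact_mod_cast hp.out.one_lt)
  exact absurd h3 (mul_lt_one_of_lt_of_le h4 h1).ne

theorem mainTheorem11
    -- the coefficient field `E`, finite over `ℚ_p`, with valuation ring `𝒪` and residue field `k`
    (p : ℕ) [Fact p.Prime]
    (E : IntermediateField ℚ_[p] (PadicAlgCl p)) [FiniteDimensional ℚ_[p] E]
    -- `k` is discrete
    [TopologicalSpace (padicResidueField p E)] [DiscreteTopology (padicResidueField p E)]
    -- the number field `F` and its finite place `v`; `q_v = 1` in `k`
    (F : Type*) [Field F] [NumberField F] (v : HeightOneSpectrum (𝓞 F))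
    (hq : (Nat.card (IsLocalRing.ResidueField (v.adicCompletionIntegers F)) :
      padicResidueField p E) = 1)
    -- `A` is a complete noetherian local `𝒪`-algebra with residue field `k`, with the
    -- `𝔪_A`-adic topology, and `𝔪_A` is principal
    (A : Type*) [CommRing A] [IsLocalRing A] [IsNoetherianRing A]
    [IsAdicComplete (IsLocalRing.maximalIdeal A) A]
    [Algebra (padicValuationRing p E) A] [IsLocalHom (algebraMap (padicValuationRing p E) A)]
    (hres : Function.Bijective
      (algebraMap (padicResidueField p E) (IsLocalRing.ResidueField A)))
    [TopologicalSpace A] (htop : IsAdic (IsLocalRing.maximalIdeal A))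
    (hprin : (IsLocalRing.maximalIdeal A).IsPrincipal)
    -- the residual representation and its decomposition
    (n₁ n₂ : ℕ)
    (rbar : LocalGalois (v.adicCompletion F) →* GL (Fin n₁ ⊕ Fin n₂) (padicResidueField p E))
    (hcont : Continuous rbar) (hunr : IsUnramifiedRep rbar)
    (rbar₁ : LocalGalois (v.adicCompletion F) →* GL (Fin n₁) (padicResidueField p E))
    (rbar₂ : LocalGalois (v.adicCompletion F) →* GL (Fin n₂) (padicResidueField p E))
    (hsum : rbar = directSumRep rbar₁ rbar₂)
    (φ : LocalGalois (v.adicCompletion F))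
    (hφ : IsGeometricFrobenius (v.adicCompletion F)
      (Nat.card (IsLocalRing.ResidueField (v.adicCompletionIntegers F))) φ)
    (hcop : IsCoprime
      (rbar₁ φ : Matrix (Fin n₁) (Fin n₁) (padicResidueField p E)).charpoly
      (rbar₂ φ : Matrix (Fin n₂) (Fin n₂) (padicResidueField p E)).charpoly)
    -- a lift of the residual representation
    (r : LocalGalois (v.adicCompletion F) →* GL (Fin n₁ ⊕ Fin n₂) A)
    (hr : IsLift rbar r) :
    ∃ X : GL (Fin n₁ ⊕ Fin n₂) A,
      (∀ i j, ((X : Matrix (Fin n₁ ⊕ Fin n₂) (Fin n₁ ⊕ Fin n₂) A) - 1) i j ∈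
        IsLocalRing.maximalIdeal A) ∧
      ∃ (r₁ : LocalGalois (v.adicCompletion F) →* GL (Fin n₁) A)
        (r₂ : LocalGalois (v.adicCompletion F) →* GL (Fin n₂) A),
        IsLift rbar₁ r₁ ∧ IsLift rbar₂ r₂ ∧
        ∀ σ, X * r σ * X⁻¹ = directSumRep r₁ r₂ σ := by
  -- The existing normed field structure is extended, so that inertia and Frobenius keep the meaning
  -- they have in the statement.
  let _ : NontriviallyNormedField (v.adicCompletion F) :=
    { (inferInstance : NormedField (v.adicCompletion F)) with
      non_trivial := (Valued.toNontriviallyNormedField (v.adicCompletion F) (WithZero (Multiplicative ℤ))).non_trivial }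
  have : CharZero (v.adicCompletion F) :=
    charZero_of_injective_algebraMap (algebraMap F (v.adicCompletion F)).injective
  subst hsum
  exact exists_conj_eq_directSumRep_of_isCoprime_charpoly (v.adicCompletionIntegers F)
    (fun x => by
      rw [HeightOneSpectrum.mem_adicCompletionIntegers, Valued.toNormedField.norm_le_one_iff])
    (p := p) hq htop hunr hφ hcop hr
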